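/- Let $\Phi$ be a unital commutative ring and let $L=L_{-1}\oplus L_0\oplus L_1$ be a semiprime 3-graded Lie algebra over $\Phi$, that is, a $\mathbb{Z}$-graded Lie algebra with $L_n=0$ for $n\notin\{-1,0,1\}$ such that $[I,I]\neq 0$ for every nonzero ideal $I$ of $L$. An ideal is essential if it meets every nonzero ideal nontrivially; a graded ideal is graded essential if it meets every nonzero graded ideal nontrivially. Let $Q_m(L)=\varinjlim \mathrm{Der}(I,L)$, over the essential ideals $I$ of $L$, be the maximal algebra of quotients of $L$, and let $Q_{gr\text{-}m}(L)=\varinjlim \mathrm{Der}_{gr}(I,L)$, over the graded essential ideals $I$ of $L$, be the maximal graded algebra of quotients of $L$. Here $\mathrm{Der}(I,L)$ is the module of derivations $I\to L$ and $\mathrm{Der}_{gr}(I,L)=\bigoplus_{n\in\mathbb{Z}}\mathrm{Der}_{gr}(I,L)_n$, where $\mathrm{Der}_{gr}(I,L)_n$ consists of the derivations $\delta:I\to L$ of degree $n$, i.e. with $\delta(I\cap L_k)\subseteq L_{k+n}$ for all $k$; the transition maps are restrictions, the bracket of the classes of $\delta:I\to L$ and $\mu:J\to L$ is the class of $\delta\mu-\mu\delta$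 on $[I\cap J,I\cap J]$, $L$ is mapped to both algebras by $x\mapsto \mathrm{ad}\,x$, and $Q_{gr\text{-}m}(L)_n$ is the set of classes of derivations of degree $n$. Then there is a $\mathbb{Z}$-grading $Q_m(L)=\bigoplus_n Q_m(L)_n$ of the Lie algebra $Q_m(L)$, with $L_n$ mapped into $Q_m(L)_n$ for all $n$, such that: (i) there is an isomorphism of Lie algebras $Q_m(L)\to Q_{gr\text{-}m}(L)$ that maps $Q_m(L)_n$ onto $Q_{gr\text{-}m}(L)_n$ for every $n$ and is compatible with the maps from $L$; (ii) if $L$ is strongly nondegenerate (that is, $[x,[x,L]]=0$ with $x \in L$ implies $x=0$) and $L$ is 2- and 3-torsion free (that is, $2x=0$ or $3x=0$ with $x\in L$ implies $x=0$), then this grading is a 3-grading, i.e. $Q_m(L)_n=0$ for $n\notin\{-1,0,1\}$, and $Q_m(L)$ is strongly nondegenerate. -/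

import Mathlib

namespace LieQuot

section Basic

variable (R L : Type*) [CommRing R] [LieRing L] [LieAlgebra R L]

/-- A Lie algebra is semiprime if `[I, I] ≠ 0` for every nonzero ideal `I`. -/
class IsSemiprime : Prop where
  eq_bot_of_sq : ∀ I : LieIdeal R L, ⁅I, I⁆ = ⊥ → I = ⊥

/-- A Lie algebra is strongly nondegenerate if it has no nonzero absolute zero divisors, that is,
no `x ≠ 0` with `(ad x)² = 0`. -/
def IsStronglyNondegenerate (L : Type*) [LieRing L] : Prop :=
  ∀ x : L, (∀ y : L, ⁅x, ⁅x, y⁆⁆ = 0) → x = 0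

variable {R L}

/-- An ideal is essential if it meets every nonzero ideal in a nonzero ideal. -/
def IsEssential (I : LieIdeal R L) : Prop :=
  ∀ K : LieIdeal R L, K ≠ ⊥ → I ⊓ K ≠ ⊥

/-- `LieDerivation R I L` is the module `Der(I, L)` of derivations from the ideal `I` into `L`.
This is the restriction map `Der(J, L) → Der(I, L)` for ideals `I ⊆ J`. -/
def restrict {I J : LieIdeal R L} (h : I ≤ J) :
    LieDerivation R J L →ₗ[R] LieDerivation R I L where
  toFun δ :=
    { toLinearMap := δ.toLinearMap ∘ₗ Submodule.inclusion h
      leibniz' := fun a b => δ.apply_lie_eq_sub ⟨a, h a.2⟩ ⟨b, h b.2⟩ }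
  map_add' _ _ := rfl
  map_smul' _ _ := rfl

theorem restrict_apply {I J : LieIdeal R L} (h : I ≤ J) (δ : LieDerivation R J L) (x : I) :
    restrict h δ x = δ ⟨x, h x.2⟩ := rfl

/-- The derivation `ad x : I → L`, `y ↦ [x, y]`. -/
def adOn (I : LieIdeal R L) : L →ₗ[R] LieDerivation R I L where
  toFun x :=
    { toFun := fun y => ⁅x, (y : L)⁆
      map_add' := fun a b => by simp
      map_smul' := fun r a => by simp
      leibniz' := fun a b => by
        simp only [LinearMap.coe_mk, AddHom.coe_mk, LieSubmodule.coe_bracket,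
          LieIdeal.coe_bracket_of_module]
        rw [leibniz_lie x (a : L) (b : L), ← lie_skew (b : L) ⁅x, (a : L)⁆]
        abel }
  map_add' a b := by ext; simp
  map_smul' r a := by ext; simp

theorem adOn_apply (I : LieIdeal R L) (x : L) (y : I) : adOn I x y = ⁅x, (y : L)⁆ := rfl

/-- A derivation defined on `J` maps `[K, K]` into `K`, for ideals `K ⊆ J`. -/
theorem apply_mem_of_mem_sq {J K : LieIdeal R L} (h : K ≤ J) (δ : LieDerivation R J L)
    {x : L} (hx : x ∈ ⁅K, K⁆) (hxJ : x ∈ J) : δ ⟨x, hxJ⟩ ∈ K := by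
  suffices H : ⁅K, K⁆.toSubmodule ≤
      (K.toSubmodule.comap δ.toLinearMap).map J.toSubmodule.subtype by
    obtain ⟨y, hy, rfl⟩ := H hx
    exact hy
  rw [LieSubmodule.lieIdeal_oper_eq_linear_span', Submodule.span_le]
  rintro _ ⟨a, ha, b, hb, rfl⟩
  refine ⟨⁅(⟨a, h ha⟩ : J), (⟨b, h hb⟩ : J)⁆, ?_, rfl⟩
  change δ ⁅(⟨a, h ha⟩ : J), (⟨b, h hb⟩ : J)⁆ ∈ K
  rw [δ.apply_lie_eq_sub]
  exact sub_mem (lie_mem_left R L K _ _ ha) (lie_mem_left R L K _ _ hb)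

theorem sq_le (K : LieIdeal R L) : ⁅K, K⁆ ≤ K := LieSubmodule.lie_le_right K K

theorem der_add {I : LieIdeal R L} (δ : LieDerivation R I L) {a b c : L} (ha : a ∈ I) (hb : b ∈ I)
    (hc : c ∈ I) (h : c = a + b) : δ ⟨c, hc⟩ = δ ⟨a, ha⟩ + δ ⟨b, hb⟩ := by
  subst h
  exact map_add δ ⟨a, ha⟩ ⟨b, hb⟩

theorem der_sub {I : LieIdeal R L} (δ : LieDerivation R I L) {a b c : L} (ha : a ∈ I) (hb : b ∈ I)
    (hc : c ∈ I) (h : c = a - b) : δ ⟨c, hc⟩ = δ ⟨a, ha⟩ - δ ⟨b, hb⟩ := by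
  subst h
  exact map_sub δ ⟨a, ha⟩ ⟨b, hb⟩

theorem der_smul {I : LieIdeal R L} (δ : LieDerivation R I L) {a c : L} (r : R) (ha : a ∈ I)
    (hc : c ∈ I) (h : c = r • a) : δ ⟨c, hc⟩ = r • δ ⟨a, ha⟩ := by
  subst h
  exact map_smul δ r ⟨a, ha⟩

theorem der_lie {I : LieIdeal R L} (δ : LieDerivation R I L) {a b c : L} (ha : a ∈ I) (hb : b ∈ I)
    (hc : c ∈ I) (h : c = ⁅a, b⁆) : δ ⟨c, hc⟩ = ⁅a, δ ⟨b, hb⟩⁆ - ⁅b, δ ⟨a, ha⟩⁆ := by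
  subst h
  exact δ.apply_lie_eq_sub ⟨a, ha⟩ ⟨b, hb⟩

theorem mem_left {I J : LieIdeal R L} {x : L} (hx : x ∈ ⁅I ⊓ J, I ⊓ J⁆) : x ∈ I :=
  (sq_le (I ⊓ J) hx).1

theorem mem_right {I J : LieIdeal R L} {x : L} (hx : x ∈ ⁅I ⊓ J, I ⊓ J⁆) : x ∈ J :=
  (sq_le (I ⊓ J) hx).2

theorem apply_mem_right {I J : LieIdeal R L} (δ : LieDerivation R I L) {x : L}
    (hx : x ∈ ⁅I ⊓ J, I ⊓ J⁆) : δ ⟨x, mem_left hx⟩ ∈ J :=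
  (apply_mem_of_mem_sq inf_le_left δ hx _).2

theorem apply_mem_left {I J : LieIdeal R L} (μ : LieDerivation R J L) {x : L}
    (hx : x ∈ ⁅I ⊓ J, I ⊓ J⁆) : μ ⟨x, mem_right hx⟩ ∈ I :=
  (apply_mem_of_mem_sq inf_le_right μ hx _).1

/-- The bracket `[δ, μ] = δ μ - μ δ : (I ∩ J)² → L` of derivations `δ : I → L`, `μ : J → L`. -/
def derBracket {I J : LieIdeal R L} (δ : LieDerivation R I L) (μ : LieDerivation R J L) :
    LieDerivation R (⁅I ⊓ J, I ⊓ J⁆ : LieIdeal R L) L where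
  toFun x :=
    δ ⟨μ ⟨x, mem_right x.2⟩, apply_mem_left μ x.2⟩ - μ ⟨δ ⟨x, mem_left x.2⟩, apply_mem_right δ x.2⟩
  map_add' a b := by
    have e₁ := der_add δ (apply_mem_left μ a.2) (apply_mem_left μ b.2) (apply_mem_left μ (a + b).2)
      (der_add μ (mem_right a.2) (mem_right b.2) _ rfl)
    have e₂ := der_add μ (apply_mem_right δ a.2) (apply_mem_right δ b.2)
      (apply_mem_right δ (a + b).2) (der_add δ (mem_left a.2) (mem_left b.2) _ rfl)
    exact (congrArg₂ (· - ·) e₁ e₂).trans (add_sub_add_comm _ _ _ _)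
  map_smul' r a := by
    have e₁ := der_smul δ r (apply_mem_left μ a.2) (apply_mem_left μ (r • a).2)
      (der_smul μ r (mem_right a.2) _ rfl)
    have e₂ := der_smul μ r (apply_mem_right δ a.2) (apply_mem_right δ (r • a).2)
      (der_smul δ r (mem_left a.2) _ rfl)
    exact (congrArg₂ (· - ·) e₁ e₂).trans (smul_sub _ _ _).symm
  leibniz' a b := by
    have ha := mem_left a.2
    have hb := mem_left b.2
    have ha' := mem_right a.2
    have hb' := mem_right b.2
    have hμa := apply_mem_left μ a.2
    have hμb := apply_mem_left μ b.2
    have hδa := apply_mem_right δ a.2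
    have hδb := apply_mem_right δ b.2
    have e₁ := der_sub δ (lie_mem_left R L I _ _ ha) (lie_mem_left R L I _ _ hb)
      (apply_mem_left μ ⁅a, b⁆.2) (der_lie μ ha' hb' _ rfl)
    have e₂ := der_sub μ (lie_mem_left R L J _ _ ha') (lie_mem_left R L J _ _ hb')
      (apply_mem_right δ ⁅a, b⁆.2) (der_lie δ ha hb _ rfl)
    rw [der_lie δ ha hμb _ rfl, der_lie δ hb hμa _ rfl] at e₁
    rw [der_lie μ ha' hδb _ rfl, der_lie μ hb' hδa _ rfl] at e₂
    refine (congrArg₂ (· - ·) e₁ e₂).trans ?_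
    change _ = ⁅(a : L), δ ⟨μ ⟨b, hb'⟩, hμb⟩ - μ ⟨δ ⟨b, hb⟩, hδb⟩⁆ -
      ⁅(b : L), δ ⟨μ ⟨a, ha'⟩, hμa⟩ - μ ⟨δ ⟨a, ha⟩, hδa⟩⁆
    rw [lie_sub, lie_sub, ← lie_skew (μ ⟨b, hb'⟩), ← lie_skew (μ ⟨a, ha'⟩)]
    abel

/-- `x` lies in the domain of `[δ, μ]`, on which it takes the value `δ (μ x) - μ (δ x)`. -/
theorem derBracket_apply {I J : LieIdeal R L} (δ : LieDerivation R I L) (μ : LieDerivation R J L)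
    {x : L} (hx : x ∈ ⁅I ⊓ J, I ⊓ J⁆) :
    derBracket δ μ ⟨x, hx⟩ =
      δ ⟨μ ⟨x, mem_right hx⟩, apply_mem_left μ hx⟩ -
      μ ⟨δ ⟨x, mem_left hx⟩, apply_mem_right δ hx⟩ := rfl

theorem derBracket_add_left {I J : LieIdeal R L} (δ δ' : LieDerivation R I L)
    (μ : LieDerivation R J L) : derBracket (δ + δ') μ = derBracket δ μ + derBracket δ' μ := by
  apply LieDerivation.ext
  rintro ⟨x, hx⟩
  have e := der_add μ (apply_mem_right δ hx) (apply_mem_right δ' hx)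
    (apply_mem_right (δ + δ') hx) rfl
  exact (congrArg₂ (· - ·) (rfl : _ = _ + _) e).trans (add_sub_add_comm _ _ _ _)

theorem derBracket_add_right {I J : LieIdeal R L} (δ : LieDerivation R I L)
    (μ μ' : LieDerivation R J L) : derBracket δ (μ + μ') = derBracket δ μ + derBracket δ μ' := by
  apply LieDerivation.ext
  rintro ⟨x, hx⟩
  have e := der_add δ (apply_mem_left μ hx) (apply_mem_left μ' hx)
    (apply_mem_left (μ + μ') hx) rfl
  exact (congrArg₂ (· - ·) e (rfl : _ = _ + _)).trans (add_sub_add_comm _ _ _ _)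

theorem derBracket_smul_left {I J : LieIdeal R L} (r : R) (δ : LieDerivation R I L)
    (μ : LieDerivation R J L) : derBracket (r • δ) μ = r • derBracket δ μ := by
  apply LieDerivation.ext
  rintro ⟨x, hx⟩
  have e := der_smul μ r (apply_mem_right δ hx) (apply_mem_right (r • δ) hx) rfl
  exact (congrArg₂ (· - ·) (rfl : _ = r • _) e).trans (smul_sub _ _ _).symm

theorem derBracket_smul_right {I J : LieIdeal R L} (r : R) (δ : LieDerivation R I L)
    (μ : LieDerivation R J L) : derBracket δ (r • μ) = r • derBracket δ μ := by
  apply LieDerivation.ext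
  rintro ⟨x, hx⟩
  have e := der_smul δ r (apply_mem_left μ hx) (apply_mem_left (r • μ) hx) rfl
  exact (congrArg₂ (· - ·) e (rfl : _ = r • _)).trans (smul_sub _ _ _).symm

theorem derBracket_self {I : LieIdeal R L} (δ : LieDerivation R I L) : derBracket δ δ = 0 := by
  apply LieDerivation.ext
  rintro ⟨x, hx⟩
  exact sub_self _

/-- A downward directed family of ideals together with a submodule of `Der(I, L)` for each member
`I`, closed under restriction and under the bracket `Der(I, L) × Der(J, L) → Der((I ∩ J)², L)`. -/
structure DerSystem (R L : Type*) [CommRing R] [LieRing L] [LieAlgebra R L] where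
  ideals : Set (LieIdeal R L)
  der : ∀ I : LieIdeal R L, Submodule R (LieDerivation R I L)
  top_mem : ⊤ ∈ ideals
  inf_mem : ∀ {I J}, I ∈ ideals → J ∈ ideals → I ⊓ J ∈ ideals
  sq_mem : ∀ {I}, I ∈ ideals → ⁅I, I⁆ ∈ ideals
  ad_mem : ∀ x : L, adOn ⊤ x ∈ der ⊤
  restrict_mem : ∀ {I J} (h : I ≤ J), I ∈ ideals → J ∈ ideals →
    ∀ {δ}, δ ∈ der J → restrict h δ ∈ der I
  derBracket_mem : ∀ {I J}, I ∈ ideals → J ∈ ideals →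
    ∀ {δ μ}, δ ∈ der I → μ ∈ der J → derBracket δ μ ∈ der ⁅I ⊓ J, I ⊓ J⁆

namespace DerSystem

variable (S : DerSystem R L)

/-- The ideals of the system, ordered by reverse inclusion. -/
abbrev Index : Type _ := (S.ideals)ᵒᵈ

variable {S} in
/-- The ideal with a given index. -/
def Index.ideal (i : S.Index) : LieIdeal R L := (OrderDual.ofDual i).1

variable {S} in
theorem Index.mem (i : S.Index) : i.ideal ∈ S.ideals := (OrderDual.ofDual i).2

/-- The index of an ideal of the system. -/
def index (I : LieIdeal R L) (hI : I ∈ S.ideals) : S.Index := OrderDual.toDual ⟨I, hI⟩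

instance : Nonempty S.Index := ⟨S.index ⊤ S.top_mem⟩

instance : IsDirectedOrder S.Index :=
  ⟨fun i j => ⟨S.index (i.ideal ⊓ j.ideal) (S.inf_mem i.mem j.mem),
    show i.ideal ⊓ j.ideal ≤ i.ideal from inf_le_left,
    show i.ideal ⊓ j.ideal ≤ j.ideal from inf_le_right⟩⟩

noncomputable instance : DecidableEq S.Index := Classical.decEq _

/-- The derivations of the system that are defined on the ideal `i.ideal`. -/
abbrev Obj (i : S.Index) : Type _ := S.der i.ideal

/-- The transition maps are restrictions. -/
def trans (i j : S.Index) (h : i ≤ j) : S.Obj i →ₗ[R] S.Obj j :=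
  (restrict (show j.ideal ≤ i.ideal from h)).restrict
    fun _ hδ => S.restrict_mem h j.mem i.mem hδ

/-- The direct limit of the modules of derivations of the system. -/
def Limit : Type _ := Module.DirectLimit S.Obj S.trans

noncomputable instance : AddCommGroup S.Limit :=
  inferInstanceAs (AddCommGroup (Module.DirectLimit S.Obj S.trans))

noncomputable instance : Module R S.Limit :=
  inferInstanceAs (Module R (Module.DirectLimit S.Obj S.trans))

/-- The class `δ_I` in the direct limit of a derivation `δ : I → L`. -/
noncomputable def of (i : S.Index) : S.Obj i →ₗ[R] S.Limit :=
  Module.DirectLimit.of R S.Index S.Obj S.trans i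

theorem of_trans {i j : S.Index} (h : i ≤ j) (δ : S.Obj i) :
    S.of j (S.trans i j h δ) = S.of i δ := Module.DirectLimit.of_f

theorem exists_of (z : S.Limit) : ∃ i δ, S.of i δ = z := Module.DirectLimit.exists_of z

/-- The universal property of the limit. -/
noncomputable def lift {P : Type*} [AddCommGroup P] [Module R P] (g : ∀ i, S.Obj i →ₗ[R] P)
    (hg : ∀ i j h δ, g j (S.trans i j h δ) = g i δ) : S.Limit →ₗ[R] P :=
  Module.DirectLimit.lift R S.Index S.Obj S.trans g hg

theorem lift_of {P : Type*} [AddCommGroup P] [Module R P] (g : ∀ i, S.Obj i →ₗ[R] P)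
    (hg : ∀ i j h δ, g j (S.trans i j h δ) = g i δ) {i : S.Index} (δ : S.Obj i) :
    S.lift g hg (S.of i δ) = g i δ := Module.DirectLimit.lift_of g hg δ

theorem of_eq_of {i j k : S.Index} (δ : S.Obj i) (μ : S.Obj j) (hi : k.ideal ≤ i.ideal)
    (hj : k.ideal ≤ j.ideal)
    (h : ∀ x (hx : x ∈ k.ideal), δ.1 ⟨x, hi hx⟩ = μ.1 ⟨x, hj hx⟩) : S.of i δ = S.of j μ := by
  rw [← S.of_trans (i := i) (j := k) hi, ← S.of_trans (i := j) (j := k) hj]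
  congr 1
  apply Subtype.ext
  apply LieDerivation.ext
  rintro ⟨x, hx⟩
  exact h x hx

theorem of_eq_of_add_of {i j l k : S.Index} (δ : S.Obj i) (μ : S.Obj j) (ν : S.Obj l)
    (hi : k.ideal ≤ i.ideal) (hj : k.ideal ≤ j.ideal) (hl : k.ideal ≤ l.ideal)
    (h : ∀ x (hx : x ∈ k.ideal), δ.1 ⟨x, hi hx⟩ = μ.1 ⟨x, hj hx⟩ + ν.1 ⟨x, hl hx⟩) :
    S.of i δ = S.of j μ + S.of l ν := by
  rw [← S.of_trans (i := j) (j := k) hj, ← S.of_trans (i := l) (j := k) hl, ← map_add]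
  exact S.of_eq_of (k := k) _ _ hi le_rfl h

/-- The index of the ideal `(I ∩ J)²`. -/
def sqIndex (i j : S.Index) : S.Index :=
  S.index ⁅i.ideal ⊓ j.ideal, i.ideal ⊓ j.ideal⁆ (S.sq_mem (S.inf_mem i.mem j.mem))

/-- The bracket of two derivations of the system. -/
def objBracket {i j : S.Index} (δ : S.Obj i) (μ : S.Obj j) : S.Obj (S.sqIndex i j) :=
  ⟨derBracket δ.1 μ.1, S.derBracket_mem i.mem j.mem δ.2 μ.2⟩

theorem objBracket_apply {i j : S.Index} (δ : S.Obj i) (μ : S.Obj j) {x : L}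
    (hx : x ∈ (S.sqIndex i j).ideal) (hi : x ∈ i.ideal) (hj : x ∈ j.ideal)
    (hμ : μ.1 ⟨x, hj⟩ ∈ i.ideal) (hδ : δ.1 ⟨x, hi⟩ ∈ j.ideal) :
    (S.objBracket δ μ).1 ⟨x, hx⟩ = δ.1 ⟨μ.1 ⟨x, hj⟩, hμ⟩ - μ.1 ⟨δ.1 ⟨x, hi⟩, hδ⟩ := rfl

/-- The bilinear map `(δ, μ) ↦ [δ, μ]_{(I ∩ J)²}` into the limit. -/
noncomputable def bracketAux (i j : S.Index) : S.Obj i →ₗ[R] S.Obj j →ₗ[R] S.Limit :=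
  LinearMap.mk₂ R (fun δ μ => S.of (S.sqIndex i j) (S.objBracket δ μ))
    (fun δ δ' μ => by
      rw [← map_add]
      exact congrArg _ (Subtype.ext (derBracket_add_left δ.1 δ'.1 μ.1)))
    (fun r δ μ => by
      rw [← map_smul]
      exact congrArg _ (Subtype.ext (derBracket_smul_left r δ.1 μ.1)))
    (fun δ μ μ' => by
      rw [← map_add]
      exact congrArg _ (Subtype.ext (derBracket_add_right δ.1 μ.1 μ'.1)))
    (fun r δ μ => by
      rw [← map_smul]
      exact congrArg _ (Subtype.ext (derBracket_smul_right r δ.1 μ.1)))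

theorem bracketAux_trans_right (i : S.Index) {j k : S.Index} (h : j ≤ k) (δ : S.Obj i)
    (μ : S.Obj j) : S.bracketAux i k δ (S.trans j k h μ) = S.bracketAux i j δ μ := by
  have h' : k.ideal ≤ j.ideal := h
  exact S.of_eq_of (k := S.sqIndex i k) _ _ le_rfl
    (LieSubmodule.mono_lie (inf_le_inf_left _ h') (inf_le_inf_left _ h')) fun _ _ => rfl

theorem bracketAux_trans_left {i j : S.Index} (k : S.Index) (h : i ≤ j) (δ : S.Obj i)
    (μ : S.Obj k) : S.bracketAux j k (S.trans i j h δ) μ = S.bracketAux i k δ μ := by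
  have h' : j.ideal ≤ i.ideal := h
  exact S.of_eq_of (k := S.sqIndex j k) _ _ le_rfl
    (LieSubmodule.mono_lie (inf_le_inf_right _ h') (inf_le_inf_right _ h')) fun _ _ => rfl

/-- The bracket of the limit with a fixed class on the left. -/
noncomputable def bracketLeft (i : S.Index) (δ : S.Obj i) : S.Limit →ₗ[R] S.Limit :=
  S.lift (fun j => S.bracketAux i j δ) fun _ _ h μ => S.bracketAux_trans_right i h δ μ

theorem bracketLeft_of (i j : S.Index) (δ : S.Obj i) (μ : S.Obj j) :
    S.bracketLeft i δ (S.of j μ) = S.bracketAux i j δ μ := S.lift_of _ _ _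

/-- The bracket `[δ_I, μ_J] = [δ, μ]_{(I ∩ J)²}` of the limit, as a bilinear map. -/
noncomputable def bracketHom : S.Limit →ₗ[R] S.Limit →ₗ[R] S.Limit :=
  S.lift
    (fun i =>
      { toFun := S.bracketLeft i
        map_add' := fun δ δ' => by
          apply LinearMap.ext
          intro z
          obtain ⟨k, μ, rfl⟩ := S.exists_of z
          rw [LinearMap.add_apply, bracketLeft_of, bracketLeft_of, bracketLeft_of, map_add,
            LinearMap.add_apply]
        map_smul' := fun r δ => by
          apply LinearMap.ext
          intro z
          obtain ⟨k, μ, rfl⟩ := S.exists_of z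
          rw [LinearMap.smul_apply, bracketLeft_of, bracketLeft_of, map_smul,
            LinearMap.smul_apply, RingHom.id_apply] })
    (fun i j h δ => by
      apply LinearMap.ext
      intro z
      obtain ⟨k, μ, rfl⟩ := S.exists_of z
      change S.bracketLeft j _ _ = S.bracketLeft i _ _
      rw [bracketLeft_of, bracketLeft_of]
      exact S.bracketAux_trans_left k h δ μ)

noncomputable instance : Bracket S.Limit S.Limit := ⟨fun z w => S.bracketHom z w⟩

theorem bracket_def (z w : S.Limit) : ⁅z, w⁆ = S.bracketHom z w := rfl

theorem bracket_of_of (i j : S.Index) (δ : S.Obj i) (μ : S.Obj j) :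
    ⁅S.of i δ, S.of j μ⁆ = S.of (S.sqIndex i j) (S.objBracket δ μ) := by
  rw [bracket_def, bracketHom, lift_of]
  exact S.bracketLeft_of i j δ μ

theorem lie_self_limit (z : S.Limit) : ⁅z, z⁆ = 0 := by
  obtain ⟨i, δ, rfl⟩ := S.exists_of z
  rw [bracket_of_of, ← map_zero (S.of (S.sqIndex i i))]
  exact congrArg _ (Subtype.ext (derBracket_self δ.1))

theorem leibniz_limit (z w t : S.Limit) : ⁅z, ⁅w, t⁆⁆ = ⁅⁅z, w⁆, t⁆ + ⁅w, ⁅z, t⁆⁆ := by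
  obtain ⟨i, α, rfl⟩ := S.exists_of z
  obtain ⟨j, β, rfl⟩ := S.exists_of w
  obtain ⟨k, γ, rfl⟩ := S.exists_of t
  simp only [bracket_of_of]
  set K₀ : LieIdeal R L := i.ideal ⊓ j.ideal ⊓ k.ideal with hK₀
  have hI : K₀ ≤ i.ideal := inf_le_left.trans inf_le_left
  have hJ : K₀ ≤ j.ideal := inf_le_left.trans inf_le_right
  have hK : K₀ ≤ k.ideal := inf_le_right
  have hm : ⁅K₀, K₀⁆ ∈ S.ideals := S.sq_mem (S.inf_mem (S.inf_mem i.mem j.mem) k.mem)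
  have h₁ : ⁅K₀, K₀⁆ ≤ K₀ := sq_le K₀
  have h₂ : ⁅⁅K₀, K₀⁆, ⁅K₀, K₀⁆⁆ ≤ ⁅K₀, K₀⁆ := sq_le _
  have key : ∀ {a b : S.Index}, K₀ ≤ a.ideal → K₀ ≤ b.ideal → ⁅K₀, K₀⁆ ≤ (S.sqIndex a b).ideal :=
    fun ha hb => LieSubmodule.mono_lie (le_inf ha hb) (le_inf ha hb)
  have key₂ : ∀ {a b : S.Index}, ⁅K₀, K₀⁆ ≤ a.ideal → ⁅K₀, K₀⁆ ≤ b.ideal →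
      ⁅⁅K₀, K₀⁆, ⁅K₀, K₀⁆⁆ ≤ (S.sqIndex a b).ideal :=
    fun ha hb => LieSubmodule.mono_lie (le_inf ha hb) (le_inf ha hb)
  refine S.of_eq_of_add_of (k := S.index _ (S.sq_mem hm)) _ _ _
    (key₂ (h₁.trans hI) (key hJ hK)) (key₂ (key hI hJ) (h₁.trans hK))
    (key₂ (h₁.trans hJ) (key hI hK)) fun x hx => ?_
  have hx' : x ∈ ⁅⁅K₀, K₀⁆, ⁅K₀, K₀⁆⁆ := hx
  have hx₁ : x ∈ ⁅K₀, K₀⁆ := h₂ hx'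
  have hx₀ : x ∈ K₀ := h₁ hx₁
  have a₁ : α.1 ⟨x, hI hx₀⟩ ∈ ⁅K₀, K₀⁆ := apply_mem_of_mem_sq (h₁.trans hI) α.1 hx' _
  have b₁ : β.1 ⟨x, hJ hx₀⟩ ∈ ⁅K₀, K₀⁆ := apply_mem_of_mem_sq (h₁.trans hJ) β.1 hx' _
  have c₁ : γ.1 ⟨x, hK hx₀⟩ ∈ ⁅K₀, K₀⁆ := apply_mem_of_mem_sq (h₁.trans hK) γ.1 hx' _
  have ab := apply_mem_of_mem_sq hI α.1 b₁ (hI (h₁ b₁))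
  have ac := apply_mem_of_mem_sq hI α.1 c₁ (hI (h₁ c₁))
  have ba := apply_mem_of_mem_sq hJ β.1 a₁ (hJ (h₁ a₁))
  have bc := apply_mem_of_mem_sq hJ β.1 c₁ (hJ (h₁ c₁))
  have ca := apply_mem_of_mem_sq hK γ.1 a₁ (hK (h₁ a₁))
  have cb := apply_mem_of_mem_sq hK γ.1 b₁ (hK (h₁ b₁))
  have eα := der_sub α.1 (hI bc) (hI cb) (hI (sub_mem bc cb)) rfl
  have eβ := der_sub β.1 (hJ ac) (hJ ca) (hJ (sub_mem ac ca)) rfl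
  have eγ := der_sub γ.1 (hK ab) (hK ba) (hK (sub_mem ab ba)) rfl
  have fα : (S.objBracket β γ).1 ⟨α.1 ⟨x, hI hx₀⟩, key hJ hK a₁⟩ = _ :=
    S.objBracket_apply β γ _ (hJ (h₁ a₁)) (hK (h₁ a₁)) (hJ ca) (hK ba)
  have fβ : (S.objBracket α γ).1 ⟨β.1 ⟨x, hJ hx₀⟩, key hI hK b₁⟩ = _ :=
    S.objBracket_apply α γ _ (hI (h₁ b₁)) (hK (h₁ b₁)) (hI cb) (hK ab)
  have fγ : (S.objBracket α β).1 ⟨γ.1 ⟨x, hK hx₀⟩, key hI hJ c₁⟩ = _ :=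
    S.objBracket_apply α β _ (hI (h₁ c₁)) (hJ (h₁ c₁)) (hI bc) (hJ ac)
  refine (congrArg₂ (· - ·) eα fα).trans (Eq.trans ?_
    (congrArg₂ (· + ·) (congrArg₂ (· - ·) fγ eγ) (congrArg₂ (· - ·) eβ fβ)).symm)
  abel

noncomputable instance : LieRing S.Limit where
  add_lie z z' w := by simp [bracket_def]
  lie_add z w w' := by simp [bracket_def]
  lie_self := S.lie_self_limit
  leibniz_lie := S.leibniz_limit

noncomputable instance : LieAlgebra R S.Limit where
  lie_smul r z w := by simp [bracket_def]

/-- The canonical homomorphism `x ↦ (ad x)_L` from `L` to the limit. -/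
noncomputable def embed : L →ₗ⁅R⁆ S.Limit where
  toFun x := S.of (S.index ⊤ S.top_mem) ⟨adOn ⊤ x, S.ad_mem x⟩
  map_add' x y := by
    rw [← map_add]; congr 1; apply Subtype.ext; exact map_add _ _ _
  map_smul' r x := by
    rw [RingHom.id_apply, ← map_smul]; congr 1; apply Subtype.ext; exact map_smul _ _ _
  map_lie' {x y} := by
    rw [bracket_of_of]
    refine S.of_eq_of (k := S.sqIndex _ _) _ _ le_top le_rfl fun u hu => ?_
    change ⁅⁅x, y⁆, u⁆ = ⁅x, ⁅y, u⁆⁆ - ⁅y, ⁅x, u⁆⁆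
    rw [leibniz_lie x y u]
    abel

end DerSystem

theorem bot_of_sq_of_inf {I K : LieIdeal R L} (h : ⁅I, I⁆ ⊓ K = ⊥) : ⁅I ⊓ K, I ⊓ K⁆ = ⊥ := by
  rw [eq_bot_iff, ← h]
  exact le_inf (LieSubmodule.mono_lie inf_le_left inf_le_left) ((sq_le _).trans inf_le_right)

theorem IsEssential.top : IsEssential (⊤ : LieIdeal R L) := fun K hK => by rwa [top_inf_eq]

theorem IsEssential.inf {I J : LieIdeal R L} (hI : IsEssential I) (hJ : IsEssential J) :
    IsEssential (I ⊓ J) := fun K hK => by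
  rw [inf_assoc]
  exact hI _ (hJ K hK)

theorem IsEssential.sq [IsSemiprime R L] {I : LieIdeal R L} (hI : IsEssential I) :
    IsEssential ⁅I, I⁆ := fun K hK h =>
  hI K hK (IsSemiprime.eq_bot_of_sq _ (bot_of_sq_of_inf h))

variable (R L) in
/-- The system of all derivations `I → L` on essential ideals `I` of a semiprime Lie algebra. -/
def essentialSystem [IsSemiprime R L] : DerSystem R L where
  ideals := {I | IsEssential I}
  der _ := ⊤
  top_mem := IsEssential.top
  inf_mem := IsEssential.inf
  sq_mem := IsEssential.sq
  ad_mem _ := trivial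
  restrict_mem _ _ _ _ _ := trivial
  derBracket_mem _ _ _ _ _ _ := trivial

variable (R L) in
/-- The maximal algebra of quotients `Q_m(L)` of a semiprime Lie algebra `L`: the direct limit of
`Der(I, L)` over the essential ideals `I` of `L`. -/
abbrev Qm [IsSemiprime R L] : Type _ := (essentialSystem R L).Limit

variable (R L) in
/-- The canonical homomorphism `L → Q_m(L)`, `x ↦ (ad x)_L`. -/
noncomputable abbrev toQm [IsSemiprime R L] : L →ₗ⁅R⁆ Qm R L := (essentialSystem R L).embed

end Basic

section Graded

set_option linter.unusedSectionVars false

variable {R L G : Type*} [CommRing R] [LieRing L] [LieAlgebra R L] [AddCommGroup G] [DecidableEq G]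
  (𝒜 : G → Submodule R L) [GradedLieAlgebra 𝒜]

/-- A graded ideal contains the homogeneous components of its elements. -/
def IsGradedIdeal (I : LieIdeal R L) : Prop :=
  ∀ x ∈ I, ∀ σ : G, (DirectSum.decompose 𝒜 x σ : L) ∈ I

/-- A graded Lie algebra is graded semiprime if `[I, I] ≠ 0` for every nonzero graded ideal `I`. -/
class IsGradedSemiprime : Prop where
  eq_bot_of_sq : ∀ I : LieIdeal R L, IsGradedIdeal 𝒜 I → ⁅I, I⁆ = ⊥ → I = ⊥

instance [IsSemiprime R L] : IsGradedSemiprime 𝒜 :=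
  ⟨fun I _ h => IsSemiprime.eq_bot_of_sq I h⟩

/-- A graded essential ideal is a graded ideal that meets every nonzero graded ideal in a nonzero
ideal. -/
def IsGradedEssential (I : LieIdeal R L) : Prop :=
  IsGradedIdeal 𝒜 I ∧ ∀ K : LieIdeal R L, IsGradedIdeal 𝒜 K → K ≠ ⊥ → I ⊓ K ≠ ⊥

/-- The module `Der_gr(I, L)_σ` of graded derivations `I → L` of degree `σ`. -/
def derDegree (I : LieIdeal R L) (σ : G) : Submodule R (LieDerivation R I L) where
  carrier := {δ | ∀ (τ : G) (x : I), (x : L) ∈ 𝒜 τ → δ x ∈ 𝒜 (τ + σ)}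
  zero_mem' := fun τ _ _ => zero_mem (𝒜 (τ + σ))
  add_mem' := fun h h' τ x hx => add_mem (h τ x hx) (h' τ x hx)
  smul_mem' := fun r _ h τ x hx => Submodule.smul_mem _ r (h τ x hx)

/-- The module `Der_gr(I, L)`, the sum of the modules `Der_gr(I, L)_σ`. -/
def derGr (I : LieIdeal R L) : Submodule R (LieDerivation R I L) := ⨆ σ, derDegree 𝒜 I σ

variable {𝒜}

theorem IsGradedIdeal.inf {I J : LieIdeal R L} (hI : IsGradedIdeal 𝒜 I)
    (hJ : IsGradedIdeal 𝒜 J) : IsGradedIdeal 𝒜 (I ⊓ J) :=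
  fun x hx σ => ⟨hI x hx.1 σ, hJ x hx.2 σ⟩

theorem IsGradedIdeal.sq {I : LieIdeal R L} (hI : IsGradedIdeal 𝒜 I) :
    IsGradedIdeal 𝒜 ⁅I, I⁆ := by
  intro x hx σ
  have hx' : x ∈ ⁅I, I⁆.toSubmodule := hx
  rw [LieSubmodule.lieIdeal_oper_eq_linear_span'] at hx'
  clear hx
  induction hx' using Submodule.span_induction with
  | mem x hx =>
    obtain ⟨a, ha, b, hb, rfl⟩ := hx
    classical
    have hab : ⁅a, b⁆ = ∑ s ∈ (DirectSum.decompose 𝒜 a).support,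
        ∑ t ∈ (DirectSum.decompose 𝒜 b).support,
          ⁅(DirectSum.decompose 𝒜 a s : L), (DirectSum.decompose 𝒜 b t : L)⁆ := by
      conv_lhs => rw [← DirectSum.sum_support_decompose 𝒜 a, ← DirectSum.sum_support_decompose 𝒜 b]
      rw [sum_lie]
      exact Finset.sum_congr rfl fun s _ => lie_sum _ _ _
    rw [hab, DirectSum.decompose_sum, DFinsupp.finsetSum_apply, AddSubmonoidClass.coe_finsetSum]
    refine sum_mem fun s _ => ?_
    rw [DirectSum.decompose_sum, DFinsupp.finsetSum_apply, AddSubmonoidClass.coe_finsetSum]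
    refine sum_mem fun t _ => ?_
    have h : ⁅(DirectSum.decompose 𝒜 a s : L), (DirectSum.decompose 𝒜 b t : L)⁆ ∈ 𝒜 (s + t) :=
      SetLike.GradedBracket.bracket_mem (SetLike.coe_mem _) (SetLike.coe_mem _)
    by_cases hσ : s + t = σ
    · rw [← hσ, DirectSum.decompose_of_mem_same 𝒜 h]
      exact LieSubmodule.lie_mem_lie (hI a ha s) (hI b hb t)
    · rw [DirectSum.decompose_of_mem_ne 𝒜 h hσ]
      exact zero_mem _
  | zero =>
    rw [DirectSum.decompose_zero, DirectSum.zero_apply]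
    exact zero_mem _
  | add x y _ _ hx hy =>
    rw [DirectSum.decompose_add, DirectSum.add_apply]
    exact add_mem hx hy
  | smul r x _ hx =>
    rw [DirectSum.decompose_smul, DirectSum.smul_apply]
    exact Submodule.smul_mem _ r hx

theorem IsGradedEssential.top : IsGradedEssential 𝒜 ⊤ :=
  ⟨fun _ _ _ => trivial, fun K _ hK => by rwa [top_inf_eq]⟩

theorem IsGradedEssential.inf {I J : LieIdeal R L} (hI : IsGradedEssential 𝒜 I)
    (hJ : IsGradedEssential 𝒜 J) : IsGradedEssential 𝒜 (I ⊓ J) :=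
  ⟨hI.1.inf hJ.1, fun K hgK hK => by
    rw [inf_assoc]
    exact hI.2 _ (hJ.1.inf hgK) (hJ.2 K hgK hK)⟩

theorem IsGradedEssential.sq [IsGradedSemiprime 𝒜] {I : LieIdeal R L}
    (hI : IsGradedEssential 𝒜 I) : IsGradedEssential 𝒜 ⁅I, I⁆ :=
  ⟨hI.1.sq, fun K hgK hK h =>
    hI.2 K hgK hK (IsGradedSemiprime.eq_bot_of_sq (𝒜 := 𝒜) _ (hI.1.inf hgK)
      (bot_of_sq_of_inf h))⟩

theorem adOn_mem_derGr (I : LieIdeal R L) (x : L) : adOn I x ∈ derGr 𝒜 I := by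
  classical
  rw [← DirectSum.sum_support_decompose 𝒜 x, map_sum]
  refine sum_mem fun σ _ => Submodule.mem_iSup_of_mem σ fun τ y hy => ?_
  rw [add_comm]
  exact SetLike.GradedBracket.bracket_mem (SetLike.coe_mem _) hy

theorem restrict_mem_derGr {I J : LieIdeal R L} (h : I ≤ J) {δ : LieDerivation R J L}
    (hδ : δ ∈ derGr 𝒜 J) : restrict h δ ∈ derGr 𝒜 I := by
  suffices H : derGr 𝒜 J ≤ (derGr 𝒜 I).comap (restrict h) from H hδ
  exact iSup_le fun σ δ hδ => Submodule.mem_iSup_of_mem σ fun τ x hx => hδ τ ⟨x, h x.2⟩ hx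

theorem derBracket_mem_derDegree {I J : LieIdeal R L} {δ : LieDerivation R I L}
    {μ : LieDerivation R J L} {σ ρ : G} (hδ : δ ∈ derDegree 𝒜 I σ) (hμ : μ ∈ derDegree 𝒜 J ρ) :
    derBracket δ μ ∈ derDegree 𝒜 ⁅I ⊓ J, I ⊓ J⁆ (σ + ρ) := by
  rintro τ ⟨x, hx⟩ hxτ
  rw [derBracket_apply]
  have h₁ := hδ _ ⟨_, apply_mem_left μ hx⟩ (hμ τ ⟨x, mem_right hx⟩ hxτ)
  have h₂ := hμ _ ⟨_, apply_mem_right δ hx⟩ (hδ τ ⟨x, mem_left hx⟩ hxτ)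
  rw [add_assoc, add_comm ρ σ] at h₁
  rw [add_assoc] at h₂
  exact sub_mem h₁ h₂

theorem derBracket_mem_derGr {I J : LieIdeal R L} {δ : LieDerivation R I L}
    {μ : LieDerivation R J L} (hδ : δ ∈ derGr 𝒜 I) (hμ : μ ∈ derGr 𝒜 J) :
    derBracket δ μ ∈ derGr 𝒜 ⁅I ⊓ J, I ⊓ J⁆ := by
  let B : LieDerivation R I L →ₗ[R] LieDerivation R J L →ₗ[R]
      LieDerivation R (⁅I ⊓ J, I ⊓ J⁆ : LieIdeal R L) L :=
    LinearMap.mk₂ R derBracket derBracket_add_left derBracket_smul_left derBracket_add_right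
      derBracket_smul_right
  have H₁ : ∀ σ, ∀ α ∈ derDegree 𝒜 I σ, derGr 𝒜 J ≤ (derGr 𝒜 _).comap (B α) := fun σ α hα =>
    iSup_le fun ρ _ hβ => Submodule.mem_iSup_of_mem (σ + ρ) (derBracket_mem_derDegree hα hβ)
  have H₂ : derGr 𝒜 I ≤ (derGr 𝒜 _).comap (B.flip μ) := iSup_le fun σ α hα => H₁ σ α hα hμ
  exact H₂ hδ

variable (𝒜)

/-- The system of the modules `Der_gr(I, L)`, for the graded essential ideals `I` of a graded
semiprime Lie algebra. -/
def gradedEssentialSystem [IsGradedSemiprime 𝒜] : DerSystem R L where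
  ideals := {I | IsGradedEssential 𝒜 I}
  der I := derGr 𝒜 I
  top_mem := IsGradedEssential.top
  inf_mem := IsGradedEssential.inf
  sq_mem := IsGradedEssential.sq
  ad_mem x := adOn_mem_derGr ⊤ x
  restrict_mem h _ _ _ hδ := restrict_mem_derGr h hδ
  derBracket_mem _ _ _ _ hδ hμ := derBracket_mem_derGr hδ hμ

/-- The maximal graded algebra of quotients `Q_gr-m(L)` of a graded semiprime Lie algebra `L`: the
direct limit of `Der_gr(I, L)` over the graded essential ideals `I` of `L`. -/
abbrev Qgrm [IsGradedSemiprime 𝒜] : Type _ := (gradedEssentialSystem 𝒜).Limit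

/-- The canonical homomorphism `L → Q_gr-m(L)`, `x ↦ (ad x)_L`. -/
noncomputable abbrev toQgrm [IsGradedSemiprime 𝒜] : L →ₗ⁅R⁆ Qgrm 𝒜 :=
  (gradedEssentialSystem 𝒜).embed

/-- The homogeneous component of degree `σ` of `Q_gr-m(L)`, which consists of the classes `δ_I` of
the graded derivations `δ : I → L` of degree `σ`. -/
noncomputable def Qgrm.component [IsGradedSemiprime 𝒜] (σ : G) : Submodule R (Qgrm 𝒜) :=
  ⨆ i : (gradedEssentialSystem 𝒜).Index,
    ((derDegree 𝒜 i.ideal σ).comap (Submodule.subtype _)).map ((gradedEssentialSystem 𝒜).of i)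

end Graded

end LieQuot

/-! Every nonzero ideal of a semiprime 3-graded Lie algebra contains a nonzero graded ideal
(`gradedCore_ne_bot`). Hence graded essential ideals are essential, and each essential ideal
contains a graded essential one, its graded core. On a graded ideal every derivation is a finite sum
of homogeneous ones (`IsGradedIdeal.mem_derGr`), so both direct limits can be computed over the same
ideals with the same derivations. This gives the isomorphism, and the grading of `Q_m(L)` is the one
transported along it.

Part (ii) rests on `Qm.eq_zero_of_sq_lie`: no nonzero `q` in `Q_m(L)` satisfies `[q, [q, L]] = 0`.
If `q` has degree `n` with `|n| ≥ 2`, then `[q, [q, L_k]]` has degree `2n + k`, of absolute value at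
least 3, where derivations between 3-graded objects vanish; so `q = 0`. Strong nondegeneracy of
`Q_m(L)` is immediate.

The statement about `q` is a computation in a Lie ring (`lie_eq_zero_of_sq_lie_eq_zero`). If `q`
maps an ideal `I` of `L` into `L`, then `(ad [q, x])²` kills `I` for `x` in `I`. When `[q, x]` lies
in `I`, it vanishes, since strong nondegeneracy passes to ideals (`eq_zero_of_sq_lie_ideal`). Thus
`q` kills `[I, I]`, which is essential. -/

namespace LieQuot

/-! ### Quadratic annihilators in Lie rings without 2- and 3-torsion. -/

section Sandwich

variable {M : Type*} [LieRing M]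

/-- Let `E = ad e`, `L = ad l` and `f = E²l`. Then `ad f = E²L - 2ELE + LE²`, which is `-2ELE` on
`I`. With `a = [e, m]` this gives `(ad f)² m = -2ELELE a`, and a second evaluation produces the
opposite sign. -/
theorem sq_lie_sq_eq_zero_of_ideal (h2 : ∀ x : M, 2 • x = 0 → x = 0) {S I : AddSubgroup M}
    (hI : ∀ a ∈ S, ∀ b ∈ I, ⁅a, b⁆ ∈ I) {e : M} (heI : e ∈ I) (heS : e ∈ S)
    (he : ∀ y ∈ I, ⁅e, ⁅e, y⁆⁆ = 0) {l m : M} (hl : l ∈ S) (hm : m ∈ S) :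
    ⁅⁅e, ⁅e, l⁆⁆, ⁅⁅e, ⁅e, l⁆⁆, m⁆⁆ = 0 := by
  have hS : ∀ b ∈ S, ⁅e, b⁆ ∈ I := fun b hb => by
    rw [← lie_skew e b]; exact neg_mem (hI b hb e heI)
  have hE : ∀ b ∈ I, ⁅e, b⁆ ∈ I := fun b hb => hI e heS b hb
  have hl' : ∀ b ∈ I, ⁅l, b⁆ ∈ I := fun b hb => hI l hl b hb
  have F : ∀ i : M, ⁅⁅e, ⁅e, l⁆⁆, i⁆ = ⁅e, ⁅e, ⁅l, i⁆⁆⁆ - 2 • ⁅e, ⁅l, ⁅e, i⁆⁆⁆ + ⁅l, ⁅e, ⁅e, i⁆⁆⁆ := by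
    intro i
    simp only [lie_lie, lie_sub]
    abel
  have FI : ∀ i ∈ I, ⁅⁅e, ⁅e, l⁆⁆, i⁆ = - (2 • ⁅e, ⁅l, ⁅e, i⁆⁆⁆) := by
    intro i hi
    rw [F, he _ (hl' _ hi), he _ hi, lie_zero]; abel
  have ha := hS m hm
  set a := ⁅e, m⁆ with ha_def
  have hsq : ⁅⁅e, ⁅e, l⁆⁆, ⁅⁅e, ⁅e, l⁆⁆, m⁆⁆ = - (2 • ⁅e, ⁅l, ⁅e, ⁅l, ⁅e, a⁆⁆⁆⁆⁆) := by
    have hmem : ⁅⁅e, ⁅e, l⁆⁆, m⁆ ∈ I := by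
      rw [← lie_skew _ m]; exact neg_mem (hI m hm _ (hE _ (hS l hl)))
    rw [FI _ hmem, F m, ← ha_def]
    have h1 : ⁅e, ⁅e, ⁅e, ⁅l, m⁆⁆⁆⁆ = 0 := by
      have h := lie_lie e l m
      rw [← ha_def] at h
      have h' : ⁅e, ⁅l, m⁆⁆ = ⁅⁅e, l⁆, m⁆ + ⁅l, a⁆ := by rw [h]; abel
      rw [h', lie_add, lie_add, he _ (hl' _ ha), add_zero, he]
      rw [← lie_skew]; exact neg_mem (hI m hm _ (hS l hl))
    have h2' : ⁅e, ⁅e, ⁅l, a⁆⁆⁆ = 0 := he _ (hl' _ ha)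
    simp only [lie_sub, lie_add, lie_nsmul, h1, h2', lie_zero]
    simp
  -- The formula on `I` and the Leibniz rule express `[f, [e, l]]` as `-2` and `-1` times this
  -- element, so it vanishes without any torsion hypothesis.
  have key : ⁅e, ⁅l, ⁅e, ⁅e, l⁆⁆⁆⁆ = 0 := by
    have h1 := FI _ (hS l hl)
    have h2' : ⁅⁅e, ⁅e, l⁆⁆, ⁅e, l⁆⁆ = - ⁅e, ⁅l, ⁅e, ⁅e, l⁆⁆⁆⁆ := by
      have h3 : ⁅⁅e, ⁅e, l⁆⁆, e⁆ = 0 := by rw [← lie_skew, he _ (hS l hl), neg_zero]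
      rw [leibniz_lie, h3, zero_lie, zero_add, ← lie_skew l, lie_neg, neg_neg]
    rw [h2'] at h1
    have h4 := sub_eq_zero.2 h1
    rw [← h4]; abel
  have hz : ⁅⁅⁅e, ⁅e, l⁆⁆, l⁆, e⁆ = 0 := by
    rw [← lie_skew ⁅⁅e, ⁅e, l⁆⁆, l⁆ e, ← lie_skew ⁅e, ⁅e, l⁆⁆ l, lie_neg, key]; simp
  have hfe : ⁅⁅e, ⁅e, l⁆⁆, e⁆ = 0 := by rw [← lie_skew, he _ (hS l hl), neg_zero]
  have hEa : ⁅⁅e, ⁅e, l⁆⁆, ⁅e, a⁆⁆ = 0 := by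
    rw [FI _ (hE _ ha), he _ ha]; simp
  have hEl : ⁅⁅e, ⁅e, l⁆⁆, ⁅e, ⁅l, a⁆⁆⁆ = 0 := by
    rw [FI _ (hE _ (hl' _ ha)), he _ (hl' _ ha)]; simp
  -- The bracket of `f` with `[l, [e, a]]` is computed by the formula on `I` and then by the Leibniz
  -- rule; the two values are negatives of each other.
  have c1 : ⁅⁅e, ⁅e, l⁆⁆, ⁅l, ⁅e, a⁆⁆⁆ = - (2 • ⁅e, ⁅l, ⁅e, ⁅l, ⁅e, a⁆⁆⁆⁆⁆) :=
    FI _ (hl' _ (hE _ ha))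
  have c2 : ⁅⁅e, ⁅e, l⁆⁆, ⁅l, ⁅e, a⁆⁆⁆ = 2 • ⁅e, ⁅l, ⁅e, ⁅l, ⁅e, a⁆⁆⁆⁆⁆ := by
    rw [leibniz_lie, hEa, lie_zero, add_zero, leibniz_lie, hz, zero_lie, zero_add,
      lie_lie _ l a, FI _ ha, lie_sub]
    have : ⁅e, ⁅⁅e, ⁅e, l⁆⁆, ⁅l, a⁆⁆⁆ = ⁅⁅e, ⁅e, l⁆⁆, ⁅e, ⁅l, a⁆⁆⁆ := by
      rw [leibniz_lie ⁅e, ⁅e, l⁆⁆ e, hfe, zero_lie, zero_add]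
    rw [this, hEl]
    simp
  rw [hsq]
  apply h2
  rw [two_nsmul]
  nth_rw 1 [← c1]
  rw [c2]; abel

/-- Strong nondegeneracy passes from `S` to its ideals: it is used once to kill all `[e, [e, l]]`
and once more to kill `e`. -/
theorem eq_zero_of_sq_lie_ideal (h2 : ∀ x : M, 2 • x = 0 → x = 0) {S I : AddSubgroup M}
    (hIS : I ≤ S) (hI : ∀ a ∈ S, ∀ b ∈ I, ⁅a, b⁆ ∈ I)
    (hnd : ∀ x ∈ S, (∀ y ∈ S, ⁅x, ⁅x, y⁆⁆ = 0) → x = 0) {e : M} (heI : e ∈ I)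
    (he : ∀ y ∈ I, ⁅e, ⁅e, y⁆⁆ = 0) : e = 0 := by
  have heS := hIS heI
  refine hnd e heS fun l hl => ?_
  refine hnd _ (hIS (hI _ heS _ ?_)) fun m hm => sq_lie_sq_eq_zero_of_ideal h2 hI heI heS he hl hm
  rw [← lie_skew]; exact neg_mem (hI l hl e heI)

/-- Applying `(ad q)²` to `[y, m]` leaves only the cross term `2[[q, y], [q, m]]`, and `[[q, y], [q,
m]] = [q, [y, [q, m]]]`. -/
theorem lie_lie_lie_eq_zero_of_sq (h2 : ∀ x : M, 2 • x = 0 → x = 0) {S : AddSubgroup M}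
    (hS : ∀ a ∈ S, ∀ b ∈ S, ⁅a, b⁆ ∈ S) {q : M} (hq : ∀ l ∈ S, ⁅q, ⁅q, l⁆⁆ = 0)
    {y m : M} (hy : y ∈ S) (hm : m ∈ S) : ⁅q, ⁅y, ⁅q, m⁆⁆⁆ = 0 := by
  have h := hq _ (hS y hy m hm)
  rw [leibniz_lie q y m, lie_add, leibniz_lie q ⁅q, y⁆ m, leibniz_lie q y ⁅q, m⁆, hq y hy,
    hq m hm, zero_lie, lie_zero, zero_add, add_zero, lie_lie q y ⁅q, m⁆, hq m hm, lie_zero,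
    sub_zero] at h
  exact h2 _ (by rw [two_nsmul]; exact h)

/-- Write `Q`, `X`, `U` for `ad q`, `ad x`, `ad u` with `u = X³q`, which lies in `S`. Since `Q² = 0`
and `QUQ = 0` on `S`, the square of `ad [q, u] = QU - UQ` reduces there to `-QU²Q`. Expanding `U`
binomially reduces its vanishing to `QXQ = 0` and `QX²QX²Q = 0` on `S`. -/
theorem sandwich_sq_eq_zero (h2 : ∀ x : M, 2 • x = 0 → x = 0) (h3 : ∀ x : M, 3 • x = 0 → x = 0)
    {S I : AddSubgroup M} (hIS : I ≤ S) (hS : ∀ a ∈ S, ∀ b ∈ S, ⁅a, b⁆ ∈ S)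
    (hI : ∀ a ∈ S, ∀ b ∈ I, ⁅a, b⁆ ∈ I) {q : M} (hqI : ∀ x ∈ I, ⁅q, x⁆ ∈ S)
    (hq : ∀ l ∈ S, ⁅q, ⁅q, l⁆⁆ = 0) {x l : M} (hx : x ∈ I) (hl : l ∈ S) :
    ⁅⁅q, ⁅x, ⁅x, ⁅x, q⁆⁆⁆⁆, ⁅⁅q, ⁅x, ⁅x, ⁅x, q⁆⁆⁆⁆, l⁆⁆ = 0 := by
  have hxS := hIS hx
  have D3 : ∀ {y m : M}, y ∈ S → m ∈ S → ⁅q, ⁅y, ⁅q, m⁆⁆⁆ = 0 :=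
    fun hy hm => lie_lie_lie_eq_zero_of_sq h2 hS hq hy hm
  have hX : ∀ m ∈ S, ⁅x, m⁆ ∈ S := fun m hm => hS x hxS m hm
  have hXI : ∀ m ∈ S, ⁅x, m⁆ ∈ I := fun m hm => by
    rw [← lie_skew x m]; exact neg_mem (hI m hm x hx)
  have hqx : ⁅x, q⁆ ∈ S := by rw [← lie_skew]; exact neg_mem (hqI x hx)
  have hXD : ∀ m ∈ S, ⁅x, ⁅q, m⁆⁆ ∈ S := fun m hm => by
    rw [leibniz_lie]
    exact add_mem (hS _ hqx m hm) (hqI _ (hXI m hm))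
  -- For `y = X⁴q` in `S`, expand `Q (ad y) Q = 0` binomially: only the middle term `6 QX²QX²Q`
  -- survives, and this is where 2- and 3-torsion freeness is needed.
  have D5 : ∀ {m : M}, m ∈ S → ⁅q, ⁅x, ⁅x, ⁅q, ⁅x, ⁅x, ⁅q, m⁆⁆⁆⁆⁆⁆⁆ = 0 := by
    intro m hm
    have hv := D3 (hX _ (hX _ (hX _ hqx))) hm
    have m1 := hXD m hm
    have m2 := hX _ m1
    have m3 := hX _ m2
    have m4 := hX _ m3
    have e1 := hq m hm
    have e2 := D3 hxS hm
    have e3 := D3 hxS m3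
    have e4 := hq _ m4
    simp only [lie_lie, lie_sub, e1, e2, e3, e4, lie_zero] at hv
    apply h2
    apply h3
    rw [← hv]
    abel
  set u := ⁅x, ⁅x, ⁅x, q⁆⁆⁆ with hu
  have huS : u ∈ S := hX _ (hX _ hqx)
  have hU : ∀ m : M, ⁅u, m⁆ = ⁅x, ⁅x, ⁅x, ⁅q, m⁆⁆⁆⁆ - 3 • ⁅x, ⁅x, ⁅q, ⁅x, m⁆⁆⁆⁆
      + 3 • ⁅x, ⁅q, ⁅x, ⁅x, m⁆⁆⁆⁆ - ⁅q, ⁅x, ⁅x, ⁅x, m⁆⁆⁆⁆ := by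
    intro m
    rw [hu]
    simp only [lie_lie, lie_sub]
    abel
  have l1 := hXD l hl
  have l2 := hX _ l1
  have l3 := hX _ l2
  have hw : ⁅u, ⁅q, l⁆⁆ = 3 • ⁅x, ⁅q, ⁅x, ⁅x, ⁅q, l⁆⁆⁆⁆⁆ - ⁅q, ⁅x, ⁅x, ⁅x, ⁅q, l⁆⁆⁆⁆⁆ := by
    rw [hU, hq l hl, D3 hxS hl]
    simp
  have hwS : ⁅u, ⁅q, l⁆⁆ ∈ S := by
    rw [hw]
    exact sub_mem (nsmul_mem (hXD _ l2) _) (hqI _ (hXI _ l2))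
  have main : ⁅q, ⁅u, ⁅u, ⁅q, l⁆⁆⁆⁆ = 0 := by
    have w0 : ⁅q, ⁅u, ⁅q, l⁆⁆⁆ = 0 := D3 huS hl
    have w1 : ⁅q, ⁅x, ⁅u, ⁅q, l⁆⁆⁆⁆ = 0 := by
      rw [hw, lie_sub, lie_sub, lie_nsmul, lie_nsmul, D5 hl, D3 hxS l3]
      simp
    rw [hU ⁅u, ⁅q, l⁆⁆, w0, w1]
    simp only [lie_zero, lie_sub, lie_add, lie_nsmul]
    rw [D3 hxS (hX _ (hX _ hwS)), hq _ (hX _ (hX _ (hX _ hwS)))]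
    simp
  have hul := hS u huS l hl
  simp only [lie_lie q u, lie_sub]
  rw [D3 huS hul, hq _ hul, D3 huS hl, main]
  simp

/-- With `Q = ad q` and `X = ad x`, the square of `QX - XQ` reduces on `I` to `-QX²Q`. To kill this,
consider the trilinear map `T(x, y, z) = [q, [x, [y, [q, z]]]]` on `I`: it is symmetric, and it
vanishes on the diagonal by `sandwich_sq_eq_zero` and nondegeneracy. -/
theorem sq_lie_lie_eq_zero (h2 : ∀ x : M, 2 • x = 0 → x = 0) (h3 : ∀ x : M, 3 • x = 0 → x = 0)
    {S I : AddSubgroup M} (hIS : I ≤ S) (hS : ∀ a ∈ S, ∀ b ∈ S, ⁅a, b⁆ ∈ S)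
    (hI : ∀ a ∈ S, ∀ b ∈ I, ⁅a, b⁆ ∈ I)
    (hnd : ∀ x ∈ S, (∀ y ∈ S, ⁅x, ⁅x, y⁆⁆ = 0) → x = 0)
    {q : M} (hqI : ∀ x ∈ I, ⁅q, x⁆ ∈ S)
    (hq : ∀ l ∈ S, ⁅q, ⁅q, l⁆⁆ = 0) {x y : M} (hx : x ∈ I) (hy : y ∈ I) :
    ⁅⁅q, x⁆, ⁅⁅q, x⁆, y⁆⁆ = 0 := by
  have D3 : ∀ {y m : M}, y ∈ S → m ∈ S → ⁅q, ⁅y, ⁅q, m⁆⁆⁆ = 0 :=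
    fun hy hm => lie_lie_lie_eq_zero_of_sq h2 hS hq hy hm
  have t0 : ∀ x ∈ I, ⁅q, ⁅x, ⁅x, ⁅q, x⁆⁆⁆⁆ = 0 := by
    intro x hx
    have hqx : ⁅x, q⁆ ∈ S := by rw [← lie_skew]; exact neg_mem (hqI x hx)
    have hXI : ∀ m ∈ S, ⁅x, m⁆ ∈ I := fun m hm => by
      rw [← lie_skew x m]; exact neg_mem (hI m hm x hx)
    have h := hnd _ (hqI _ (hXI _ (hIS (hXI _ hqx))))
      fun l hl => sandwich_sq_eq_zero h2 h3 hIS hS hI hqI hq hx hl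
    rw [← lie_skew x q, lie_neg, lie_neg, lie_neg, neg_eq_zero] at h
    exact h
  have s1 : ∀ {x y z : M}, x ∈ I → y ∈ I → z ∈ I →
      ⁅q, ⁅x, ⁅y, ⁅q, z⁆⁆⁆⁆ = ⁅q, ⁅y, ⁅x, ⁅q, z⁆⁆⁆⁆ := by
    intro x y z hx hy hz
    have h := D3 (hS x (hIS hx) y (hIS hy)) (hIS hz)
    rw [lie_lie, lie_sub] at h
    exact sub_eq_zero.1 h
  have s2 : ∀ {x y z : M}, x ∈ I → y ∈ I → z ∈ I →
      ⁅q, ⁅x, ⁅y, ⁅q, z⁆⁆⁆⁆ = ⁅q, ⁅x, ⁅z, ⁅q, y⁆⁆⁆⁆ := by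
    intro x y z hx hy hz
    have h := D3 (hIS hx) (hS y (hIS hy) z (hIS hz))
    rw [leibniz_lie q y z, lie_add, lie_add, ← lie_skew ⁅q, y⁆ z, lie_neg, lie_neg, add_comm,
      ← sub_eq_add_neg] at h
    exact sub_eq_zero.1 h
  -- Polarization: by symmetry, the difference of the diagonal values of `T` at `x + y` and `x - y`
  -- is `6 T(x, x, y)` plus `2 T(y, y, y)`, which is zero.
  have t1 : ∀ {x y : M}, x ∈ I → y ∈ I → ⁅q, ⁅x, ⁅x, ⁅q, y⁆⁆⁆⁆ = 0 := by
    intro x y hx hy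
    have p := t0 _ (add_mem hx hy)
    have m := t0 _ (sub_mem hx hy)
    simp only [lie_add, add_lie, t0 x hx, t0 y hy] at p
    simp only [lie_sub, sub_lie, t0 x hx, t0 y hy] at m
    rw [s2 hx hy hx, s1 hy hx hx, s2 hx hy hx, s2 hy hy hx, s2 hy hx hy, s1 hx hy hy, s2 hy hx hy] at p m
    apply h2
    apply h3
    have := congrArg₂ (· - ·) p m
    simp only [sub_zero] at this
    rw [← this]
    abel
  have e1 := D3 (hIS hx) (hS _ (hIS hx) _ (hIS hy))
  have e2 := t1 hx hy
  have e3 := D3 (hIS hx) (hIS hy)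
  have e4 := hq _ (hS _ (hIS hx) _ (hIS hy))
  simp only [lie_lie q x, lie_sub, e1, e2, e3, e4, lie_zero, sub_self]

/-- An element `q` with `[q, [q, S]] = 0`, for a strongly nondegenerate subring `S` of a Lie ring,
annihilates every square of an ideal `I` of `S` with `[q, I] ⊆ S`. -/
theorem lie_eq_zero_of_sq_lie_eq_zero (h2 : ∀ x : M, 2 • x = 0 → x = 0)
    (h3 : ∀ x : M, 3 • x = 0 → x = 0)
    {S I : AddSubgroup M} (hIS : I ≤ S) (hS : ∀ a ∈ S, ∀ b ∈ S, ⁅a, b⁆ ∈ S)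
    (hI : ∀ a ∈ S, ∀ b ∈ I, ⁅a, b⁆ ∈ I)
    (hnd : ∀ x ∈ S, (∀ y ∈ S, ⁅x, ⁅x, y⁆⁆ = 0) → x = 0)
    {q : M} (hqI : ∀ x ∈ I, ⁅q, x⁆ ∈ S)
    (hq : ∀ l ∈ S, ⁅q, ⁅q, l⁆⁆ = 0) {x : M} (hx : x ∈ I) (hqx : ⁅q, x⁆ ∈ I) : ⁅q, x⁆ = 0 :=
  eq_zero_of_sq_lie_ideal h2 hIS hI hnd hqx
    fun _ hy => sq_lie_lie_eq_zero h2 h3 hIS hS hI hnd hqI hq hx hy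

end Sandwich

end LieQuot

namespace LieQuot

/-! ### Action of quotients on `L`, and absence of quadratic annihilators. -/

section Limit

variable {R L : Type*} [CommRing R] [LieRing L] [LieAlgebra R L]

namespace DerSystem

variable (S : DerSystem R L)

theorem of_eq_zero {i : S.Index} {δ : S.Obj i} (I : LieIdeal R L) (hI : I ∈ S.ideals)
    (h : I ≤ i.ideal) (h0 : ∀ x (hx : x ∈ I), δ.1 ⟨x, h hx⟩ = 0) : S.of i δ = 0 := by
  rw [← map_zero (S.of i)]
  exact S.of_eq_of (k := S.index I hI) δ 0 h h h0

instance : DirectedSystem S.Obj fun i j h => S.trans i j h where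
  map_self _ _ := rfl
  map_map _ _ _ _ _ _ := rfl

theorem exists_of_eq_zero {i : S.Index} {δ : S.Obj i} (h : S.of i δ = 0) :
    ∃ (I : LieIdeal R L) (_ : I ∈ S.ideals) (h : I ≤ i.ideal),
      ∀ x (hx : x ∈ I), δ.1 ⟨x, h hx⟩ = 0 := by
  obtain ⟨j, hij, hj⟩ := Module.DirectLimit.of.zero_exact (G := S.Obj) (f := S.trans) h
  refine ⟨j.ideal, j.mem, hij, fun x hx => ?_⟩
  have := congrArg (fun d : S.Obj j => d.1 ⟨x, hx⟩) hj
  exact this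

/-- This turns evaluation of a derivation into a bracket inside the limit, so that the Lie ring
identities apply to classes of derivations. -/
theorem lie_of_embed (i : S.Index) (δ : S.Obj i) {x : L} (hx : x ∈ i.ideal) :
    ⁅S.of i δ, S.embed x⁆ = S.embed (δ.1 ⟨x, hx⟩) := by
  change ⁅S.of i δ, S.of _ _⁆ = S.of _ _
  rw [bracket_of_of]
  refine S.of_eq_of (k := S.sqIndex _ _) _ _ le_rfl le_top fun u hu => ?_
  have hui : u ∈ i.ideal := mem_left hu
  have e := der_lie δ.1 hx hui (lie_mem_right R L i.ideal x u hui) rfl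
  refine (congrArg (· - ⁅x, δ.1 ⟨u, hui⟩⁆) e).trans ?_
  change _ = ⁅δ.1 ⟨x, hx⟩, u⁆
  rw [← lie_skew u]
  abel

theorem eq_zero_of_nsmul_eq_zero {n : ℕ} (hn : ∀ x : L, n • x = 0 → x = 0) (z : S.Limit)
    (hz : n • z = 0) : z = 0 := by
  obtain ⟨i, δ, rfl⟩ := S.exists_of z
  rw [← map_nsmul] at hz
  obtain ⟨I, hI, h, h0⟩ := S.exists_of_eq_zero hz
  exact S.of_eq_zero I hI h fun x hx => hn _ (h0 x hx)

end DerSystem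

/-- The ideal of the elements that annihilate a given ideal. -/
def annihilator (I : LieIdeal R L) : LieIdeal R L where
  carrier := {x | ∀ y ∈ I, ⁅x, y⁆ = 0}
  zero_mem' := fun y _ => zero_lie y
  add_mem' := fun ha hb y hy => by rw [add_lie, ha y hy, hb y hy, add_zero]
  smul_mem' := fun r x hx y hy => by rw [smul_lie, hx y hy, smul_zero]
  lie_mem := fun {z x} hx y hy => by
    have h₁ : ⁅x, y⁆ = 0 := hx y hy
    have h₂ : ⁅x, ⁅z, y⁆⁆ = 0 := hx _ (lie_mem_right R L I z y hy)
    rw [lie_lie, h₁, h₂, lie_zero, sub_zero]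

variable [IsSemiprime R L]

theorem eq_bot_of_lie_eq_zero {I : LieIdeal R L} (h : ∀ x ∈ I, ∀ y ∈ I, ⁅x, y⁆ = 0) : I = ⊥ := by
  apply IsSemiprime.eq_bot_of_sq
  rw [LieSubmodule.lie_eq_bot_iff]
  exact h

theorem inf_annihilator (I : LieIdeal R L) : I ⊓ annihilator I = ⊥ :=
  eq_bot_of_lie_eq_zero fun _ hx _ hy => hx.2 _ hy.1

theorem IsEssential.annihilator_eq_bot {I : LieIdeal R L} (hI : IsEssential I) :
    annihilator I = ⊥ := by
  by_contra h
  exact hI _ h (inf_annihilator I)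

/-- An element of the kernel annihilates an essential ideal, and an essential ideal has zero
annihilator by semiprimeness. -/
theorem toQm_injective : Function.Injective (toQm R L) := by
  rw [injective_iff_map_eq_zero]
  intro x hx
  obtain ⟨I, hI, h, h0⟩ := (essentialSystem R L).exists_of_eq_zero hx
  have hI' : IsEssential I := hI
  have : x ∈ annihilator I := fun y hy => h0 y hy
  rwa [hI'.annihilator_eq_bot, LieSubmodule.mem_bot] at this

/-- A strongly nondegenerate Lie algebra has no quadratic annihilator in `Q_m(L)`. -/
theorem Qm.eq_zero_of_sq_lie (hL : IsStronglyNondegenerate L)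
    (h2 : ∀ x : L, 2 • x = 0 → x = 0) (h3 : ∀ x : L, 3 • x = 0 → x = 0) (q : Qm R L)
    (hq : ∀ l : L, ⁅q, ⁅q, toQm R L l⁆⁆ = 0) : q = 0 := by
  obtain ⟨i, δ, rfl⟩ := (essentialSystem R L).exists_of q
  -- The square of the domain is used because `δ` maps it back into the domain, as the criterion
  -- requires of `[q, x]`.
  refine (essentialSystem R L).of_eq_zero ⁅i.ideal, i.ideal⁆
    ((essentialSystem R L).sq_mem i.mem) (sq_le _) fun x hx => ?_
  have hxi : x ∈ i.ideal := sq_le _ hx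
  have hδ : δ.1 ⟨x, hxi⟩ ∈ i.ideal := apply_mem_of_mem_sq le_rfl δ.1 hx hxi
  set φ : L →+ Qm R L := (toQm R L : L →ₗ[R] Qm R L).toAddMonoidHom with hφ
  have φlie : ∀ a b : L, φ ⁅a, b⁆ = ⁅φ a, φ b⁆ := fun a b => LieHom.map_lie (toQm R L) a b
  have hof : ∀ (y : L) (hy : y ∈ i.ideal),
      ⁅(essentialSystem R L).of i δ, φ y⁆ = φ (δ.1 ⟨y, hy⟩) := fun y hy =>
    (essentialSystem R L).lie_of_embed i δ hy
  have hinj : Function.Injective φ := toQm_injective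
  have key := lie_eq_zero_of_sq_lie_eq_zero
    (fun z : Qm R L => (essentialSystem R L).eq_zero_of_nsmul_eq_zero h2 z)
    (fun z : Qm R L => (essentialSystem R L).eq_zero_of_nsmul_eq_zero h3 z)
    (S := φ.range) (I := i.ideal.toSubmodule.toAddSubgroup.map φ)
    (q := (essentialSystem R L).of i δ) (x := φ x)
    (by rintro _ ⟨y, _, rfl⟩; exact ⟨y, rfl⟩)
    (by rintro _ ⟨a, rfl⟩ _ ⟨b, rfl⟩; exact ⟨⁅a, b⁆, φlie a b⟩)
    (by
      rintro _ ⟨a, rfl⟩ _ ⟨b, hb, rfl⟩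
      exact ⟨⁅a, b⁆, lie_mem_right R L i.ideal a b hb, φlie a b⟩)
    (by
      rintro _ ⟨a, rfl⟩ ha
      rw [hL a fun y => hinj ?_, map_zero]
      rw [φlie, φlie, map_zero]
      exact ha _ ⟨y, rfl⟩)
    (by
      rintro _ ⟨y, hy, rfl⟩
      exact ⟨_, (hof y hy).symm⟩)
    (by rintro _ ⟨l, rfl⟩; exact hq l)
    ⟨x, hxi, rfl⟩
    ⟨_, hδ, (hof x hxi).symm⟩
  rw [hof x hxi] at key
  exact hinj (key.trans (map_zero φ).symm)

end Limit

end LieQuot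

namespace LieQuot

/-! ### The graded core of an ideal. -/

section GradedIdeals

variable {R L G : Type*} [CommRing R] [LieRing L] [LieAlgebra R L] [AddCommGroup G] [DecidableEq G]
  (𝒜 : G → Submodule R L) [GradedLieAlgebra 𝒜]

theorem decompose_lie_of_mem {k : G} {y : L} (hy : y ∈ 𝒜 k) (x : L) (n : G) :
    (DirectSum.decompose 𝒜 ⁅y, x⁆ (k + n) : L) = ⁅y, (DirectSum.decompose 𝒜 x n : L)⁆ := by
  induction x using DirectSum.Decomposition.inductionOn 𝒜 with
  | zero => simp
  | @homogeneous j x =>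
    have h : ⁅y, (x : L)⁆ ∈ 𝒜 (k + j) := SetLike.GradedBracket.bracket_mem hy x.2
    by_cases hj : j = n
    · subst hj
      rw [DirectSum.decompose_of_mem_same 𝒜 h, DirectSum.decompose_of_mem_same 𝒜 x.2]
    · rw [DirectSum.decompose_of_mem_ne 𝒜 h (by simpa using hj),
        DirectSum.decompose_of_mem_ne 𝒜 x.2 hj, lie_zero]
  | add a b ha hb =>
    rw [lie_add, DirectSum.decompose_add, DirectSum.add_apply, Submodule.coe_add, ha, hb,
      DirectSum.decompose_add, DirectSum.add_apply, Submodule.coe_add, lie_add]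

theorem decompose_lie_of_mem' {k : G} {y : L} (hy : y ∈ 𝒜 k) (x : L) (n : G) :
    (DirectSum.decompose 𝒜 ⁅y, x⁆ n : L) = ⁅y, (DirectSum.decompose 𝒜 x (n - k) : L)⁆ := by
  rw [← decompose_lie_of_mem 𝒜 hy, add_sub_cancel]

/-- The largest graded ideal contained in a given ideal. -/
def gradedCore (I : LieIdeal R L) : LieIdeal R L where
  carrier := {x | ∀ n, (DirectSum.decompose 𝒜 x n : L) ∈ I}
  zero_mem' := fun n => by simp
  add_mem' := fun ha hb n => by
    rw [DirectSum.decompose_add, DirectSum.add_apply]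
    exact add_mem (ha n) (hb n)
  smul_mem' := fun r x hx n => by
    rw [DirectSum.decompose_smul, DirectSum.smul_apply]
    exact Submodule.smul_mem _ r (hx n)
  lie_mem := fun {y x} hx n => by
    induction y using DirectSum.Decomposition.inductionOn 𝒜 with
    | zero => simp
    | @homogeneous j y =>
      rw [decompose_lie_of_mem' 𝒜 y.2]
      exact lie_mem_right R L I _ _ (hx _)
    | add a b ha hb =>
      rw [add_lie, DirectSum.decompose_add, DirectSum.add_apply]
      exact add_mem ha hb

variable {𝒜}

theorem gradedCore_le (I : LieIdeal R L) : gradedCore 𝒜 I ≤ I := fun x hx => by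
  classical
  rw [← DirectSum.sum_support_decompose 𝒜 x]
  exact sum_mem fun n _ => hx n

theorem mem_gradedCore_of_mem {I : LieIdeal R L} {x : L} {k : G} (hk : x ∈ 𝒜 k) (hx : x ∈ I) :
    x ∈ gradedCore 𝒜 I := fun n => by
  by_cases h : k = n
  · subst h
    rwa [DirectSum.decompose_of_mem_same 𝒜 hk]
  · rw [DirectSum.decompose_of_mem_ne 𝒜 hk h]
    exact zero_mem I

theorem isGradedIdeal_gradedCore (I : LieIdeal R L) : IsGradedIdeal 𝒜 (gradedCore 𝒜 I) :=
  fun _ hx n => mem_gradedCore_of_mem (SetLike.coe_mem _) (hx n)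

theorem gradedCore_mono {I J : LieIdeal R L} (h : I ≤ J) : gradedCore 𝒜 I ≤ gradedCore 𝒜 J :=
  fun _ hx n => h (hx n)

end GradedIdeals

/-! ### Nonzero ideals of semiprime 3-graded algebras have nonzero graded core. -/

section ThreeGraded

variable {R L : Type*} [CommRing R] [LieRing L] [LieAlgebra R L]
  {𝒜 : ℤ → Submodule R L}

theorem eq_zero_of_mem_degree (h3 : ∀ n : ℤ, n ≠ -1 → n ≠ 0 → n ≠ 1 → 𝒜 n = ⊥) {n : ℤ} {x : L}
    (hx : x ∈ 𝒜 n) (h₁ : n ≠ -1) (h₂ : n ≠ 0) (h₃ : n ≠ 1) : x = 0 := by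
  rwa [h3 n h₁ h₂ h₃, Submodule.mem_bot] at hx

variable [GradedLieAlgebra 𝒜]

theorem decompose_eq_zero_of_degree (h3 : ∀ n : ℤ, n ≠ -1 → n ≠ 0 → n ≠ 1 → 𝒜 n = ⊥) (x : L)
    {n : ℤ} (h₁ : n ≠ -1) (h₂ : n ≠ 0) (h₃ : n ≠ 1) : (DirectSum.decompose 𝒜 x n : L) = 0 :=
  eq_zero_of_mem_degree h3 (SetLike.coe_mem _) h₁ h₂ h₃

theorem eq_sum_decompose_of_finset (x : L) (s : Finset ℤ)
    (h : ∀ n ∉ s, (DirectSum.decompose 𝒜 x n : L) = 0) :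
    x = ∑ n ∈ s, (DirectSum.decompose 𝒜 x n : L) := by
  classical
  conv_lhs => rw [← DirectSum.sum_support_decompose 𝒜 x]
  refine Finset.sum_subset (fun n hn => ?_) fun n _ hn => ?_
  · by_contra hs
    rw [DFinsupp.mem_support_iff] at hn
    exact hn (Subtype.ext (h n hs))
  · rw [DFinsupp.notMem_support_iff] at hn
    rw [hn, Submodule.coe_zero]

theorem eq_sum_decompose (h3 : ∀ n : ℤ, n ≠ -1 → n ≠ 0 → n ≠ 1 → 𝒜 n = ⊥) {s : ℤ}
    (hs : s = 1 ∨ s = -1) (x : L) :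
    x = (DirectSum.decompose 𝒜 x (-s) : L) + DirectSum.decompose 𝒜 x 0 +
      DirectSum.decompose 𝒜 x s := by
  have h := eq_sum_decompose_of_finset (𝒜 := 𝒜) x {-s, 0, s} fun n hn => by
    simp only [Finset.mem_insert, Finset.mem_singleton, not_or] at hn
    exact decompose_eq_zero_of_degree h3 x (by omega) (by omega) (by omega)
  rw [Finset.sum_insert (by simp; omega), Finset.sum_insert (by simp; omega),
    Finset.sum_singleton, ← add_assoc] at h
  exact h

/-- The elements that generate an ideal contained in `L_{-s} + L_0`. -/
def lowerIdeal (h3 : ∀ n : ℤ, n ≠ -1 → n ≠ 0 → n ≠ 1 → 𝒜 n = ⊥) {s : ℤ}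
    (hs : s = 1 ∨ s = -1) : LieIdeal R L where
  carrier := {z | (DirectSum.decompose 𝒜 z s : L) = 0 ∧
    (∀ a ∈ 𝒜 s, ⁅a, (DirectSum.decompose 𝒜 z 0 : L)⁆ = 0) ∧
    ∀ a ∈ 𝒜 s, ∀ b ∈ 𝒜 s, ⁅a, ⁅b, (DirectSum.decompose 𝒜 z (-s) : L)⁆⁆ = 0}
  zero_mem' := by simp
  add_mem' := by
    rintro x y ⟨h₁, h₂, h₃⟩ ⟨k₁, k₂, k₃⟩
    refine ⟨?_, fun a ha => ?_, fun a ha b hb => ?_⟩ <;>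
      simp only [DirectSum.decompose_add, DirectSum.add_apply, Submodule.coe_add, lie_add]
    · rw [h₁, k₁, add_zero]
    · rw [h₂ a ha, k₂ a ha, add_zero]
    · rw [h₃ a ha b hb, k₃ a ha b hb, add_zero]
  smul_mem' := by
    rintro r x ⟨h₁, h₂, h₃⟩
    refine ⟨?_, fun a ha => ?_, fun a ha b hb => ?_⟩ <;>
      simp only [DirectSum.decompose_smul, DirectSum.smul_apply, Submodule.coe_smul, lie_smul]
    · rw [h₁, smul_zero]
    · rw [h₂ a ha, smul_zero]
    · rw [h₃ a ha b hb, smul_zero]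
  lie_mem := by
    rintro c x ⟨h₁, h₂, h₃⟩
    have br : ∀ {i j : ℤ} {x y : L}, x ∈ 𝒜 i → y ∈ 𝒜 j → ⁅x, y⁆ ∈ 𝒜 (i + j) := fun hx hy =>
      SetLike.GradedBracket.bracket_mem hx hy
    induction c using DirectSum.Decomposition.inductionOn 𝒜 with
    | zero => simp
    | @homogeneous k c =>
      obtain ⟨c, hc⟩ := c
      simp only [Set.mem_ofPred_eq, decompose_lie_of_mem' 𝒜 hc]
      -- Degree `s` carries each defining condition to the next one, degree 0 preserves each by the
      -- Jacobi identity, and in degree `-s` the Jacobi identity reduces the last condition to the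
      -- one on the component of degree 0.
      by_cases hk : k = s
      · subst hk
        refine ⟨?_, fun a ha => ?_, fun a ha b hb => ?_⟩
        · rw [sub_self, h₂ c hc]
        · rw [zero_sub, h₃ a ha c hc]
        · rw [decompose_eq_zero_of_degree h3 x (by omega) (by omega) (by omega)]
          simp
      by_cases hk0 : k = 0
      · subst hk0
        have e : ∀ a ∈ 𝒜 s, ⁅a, c⁆ ∈ 𝒜 s := fun a ha => by simpa using br ha hc
        refine ⟨?_, fun a ha => ?_, fun a ha b hb => ?_⟩ <;> rw [sub_zero]
        · rw [h₁, lie_zero]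
        · rw [leibniz_lie, h₂ a ha, h₂ _ (e a ha), lie_zero, add_zero]
        · rw [leibniz_lie b, lie_add, h₃ a ha _ (e b hb), leibniz_lie a, h₃ _ (e a ha) b hb,
            h₃ a ha b hb]
          simp
      by_cases hk1 : k = -s
      · subst hk1
        have e : ∀ b ∈ 𝒜 s, ⁅b, c⁆ ∈ 𝒜 0 := fun a ha => by simpa using br ha hc
        have e' : ∀ a ∈ 𝒜 s, ∀ b ∈ 𝒜 s, ⁅a, ⁅b, c⁆⁆ ∈ 𝒜 s := fun a ha b hb => by
          simpa using br ha (e b hb)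
        refine ⟨?_, fun a ha => ?_, fun a ha b hb => ?_⟩
        · rw [decompose_eq_zero_of_degree h3 x (by omega) (by omega) (by omega), lie_zero]
        · rw [zero_sub, neg_neg, h₁, lie_zero, lie_zero]
        · rw [sub_self, leibniz_lie b, h₂ b hb, lie_zero, add_zero, leibniz_lie a,
            h₂ _ (e' a ha b hb), h₂ a ha]
          simp
      · have : c = 0 := eq_zero_of_mem_degree h3 hc (by omega) (by omega) (by omega)
        subst this
        simp
    | add a b ha hb =>
      simp only [Set.mem_ofPred_eq] at ha hb ⊢
      simp only [add_lie, DirectSum.decompose_add, DirectSum.add_apply, Submodule.coe_add, lie_add]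
      refine ⟨?_, fun c hc => ?_, fun c hc d hd => ?_⟩
      · rw [ha.1, hb.1, add_zero]
      · rw [ha.2.1 c hc, hb.2.1 c hc, add_zero]
      · rw [ha.2.2 c hc d hd, hb.2.2 c hc d hd, add_zero]

/-- All such `w` form an ideal, which is abelian because `L_{-2s} = 0`. -/
theorem eq_zero_of_lie_degree_eq_zero [IsSemiprime R L]
    (h3 : ∀ n : ℤ, n ≠ -1 → n ≠ 0 → n ≠ 1 → 𝒜 n = ⊥) {s : ℤ} (hs : s = 1 ∨ s = -1) {w : L}
    (hw : w ∈ 𝒜 (-s)) (h : ∀ a ∈ 𝒜 s, ⁅a, w⁆ = 0) : w = 0 := by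
  have br : ∀ {i j : ℤ} {x y : L}, x ∈ 𝒜 i → y ∈ 𝒜 j → ⁅x, y⁆ ∈ 𝒜 (i + j) := fun hx hy =>
    SetLike.GradedBracket.bracket_mem hx hy
  have low : ∀ x ∈ 𝒜 (-s), ∀ y ∈ 𝒜 (-s), ⁅x, y⁆ = 0 := fun x hx y hy =>
    eq_zero_of_mem_degree h3 (br hx hy) (by omega) (by omega) (by omega)
  let W : LieIdeal R L :=
    { carrier := {w | w ∈ 𝒜 (-s) ∧ ∀ a ∈ 𝒜 s, ⁅a, w⁆ = 0}
      zero_mem' := ⟨zero_mem _, fun a _ => lie_zero a⟩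
      add_mem' := fun hx hy => ⟨add_mem hx.1 hy.1, fun a ha => by
        rw [lie_add, hx.2 a ha, hy.2 a ha, add_zero]⟩
      smul_mem' := fun r x hx => ⟨Submodule.smul_mem _ r hx.1, fun a ha => by
        rw [lie_smul, hx.2 a ha, smul_zero]⟩
      lie_mem := fun {c x} hx => by
        change _ ∧ _
        induction c using DirectSum.Decomposition.inductionOn 𝒜 with
        | zero => simp
        | @homogeneous k c =>
          obtain ⟨c, hc⟩ := c
          by_cases hk : k = s
          · subst hk
            simp [hx.2 c hc]
          by_cases hk0 : k = 0
          · subst hk0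
            refine ⟨by simpa using br hc hx.1, fun a ha => ?_⟩
            have : ⁅a, c⁆ ∈ 𝒜 s := by simpa using br ha hc
            rw [leibniz_lie, hx.2 a ha, hx.2 _ this, lie_zero, add_zero]
          by_cases hk1 : k = -s
          · subst hk1
            simp [low c hc x hx.1]
          · have : c = 0 := eq_zero_of_mem_degree h3 hc (by omega) (by omega) (by omega)
            subst this
            simp
        | add a b ha hb =>
          refine ⟨by rw [add_lie]; exact add_mem ha.1 hb.1, fun d hd => ?_⟩
          rw [add_lie, lie_add, ha.2 d hd, hb.2 d hd, add_zero] }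
  have hW : W = ⊥ := eq_bot_of_lie_eq_zero fun x hx y hy => low x hx.1 y hy.1
  have : w ∈ W := ⟨hw, h⟩
  rwa [hW, LieSubmodule.mem_bot] at this

/-- Here `I` has no nonzero homogeneous elements. The component `w` of `x` in degree `-s` lies in
the ideal `U` and annihilates it, so it vanishes by semiprimeness. The sign `s` covers both ends of
the grading at once. -/
theorem decompose_eq_zero_of_gradedCore_eq_bot [IsSemiprime R L]
    (h3 : ∀ n : ℤ, n ≠ -1 → n ≠ 0 → n ≠ 1 → 𝒜 n = ⊥) {I : LieIdeal R L}
    (hI : gradedCore 𝒜 I = ⊥) {s : ℤ} (hs : s = 1 ∨ s = -1) {x : L} (hx : x ∈ I) :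
    (DirectSum.decompose 𝒜 x (-s) : L) = 0 := by
  have br : ∀ {i j : ℤ} {x y : L}, x ∈ 𝒜 i → y ∈ 𝒜 j → ⁅x, y⁆ ∈ 𝒜 (i + j) := fun hx hy =>
    SetLike.GradedBracket.bracket_mem hx hy
  have hom : ∀ {k : ℤ} {y : L}, y ∈ 𝒜 k → y ∈ I → y = 0 := fun hk hy => by
    have := mem_gradedCore_of_mem hk hy
    rwa [hI, LieSubmodule.mem_bot] at this
  set U := lowerIdeal h3 hs with hU
  -- For such `z`, brackets with `L_s` are homogeneous elements of `I`, hence zero. This kills the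
  -- component in degree `-s` and makes `z` itself homogeneous.
  have hIU : ∀ z ∈ I, z ∈ U → z = 0 := by
    intro z hz hzU
    have e := eq_sum_decompose h3 hs z
    rw [hzU.1, add_zero] at e
    have hlow : (DirectSum.decompose 𝒜 z (-s) : L) = 0 :=
      eq_zero_of_lie_degree_eq_zero h3 hs (SetLike.coe_mem _) fun a ha => by
        refine hom (br ha (SetLike.coe_mem _)) ?_
        have : ⁅a, z⁆ ∈ I := lie_mem_right R L I a z hz
        rw [e, lie_add, hzU.2.1 a ha, add_zero] at this
        exact this
    rw [hlow, zero_add] at e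
    have h0 : z ∈ 𝒜 0 := by rw [e]; exact SetLike.coe_mem _
    exact hom h0 hz
  have h0 : ∀ u ∈ U, (DirectSum.decompose 𝒜 u 0 : L) ∈ U := by
    intro u hu
    have hm := SetLike.coe_mem (DirectSum.decompose 𝒜 u 0)
    refine ⟨?_, fun a ha => ?_, fun a _ b _ => ?_⟩
    · rw [DirectSum.decompose_of_mem_ne 𝒜 hm (by omega)]
    · rw [DirectSum.decompose_of_mem_same 𝒜 hm, hu.2.1 a ha]
    · rw [DirectSum.decompose_of_mem_ne 𝒜 hm (by omega), lie_zero, lie_zero]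
  set w : L := (DirectSum.decompose 𝒜 x (-s) : L) with hw
  have hwm : w ∈ 𝒜 (-s) := SetLike.coe_mem _
  have hwU : w ∈ U := by
    refine ⟨?_, fun a ha => ?_, fun a ha b hb => ?_⟩
    · rw [DirectSum.decompose_of_mem_ne 𝒜 hwm (by omega)]
    · rw [DirectSum.decompose_of_mem_ne 𝒜 hwm (by omega), lie_zero]
    -- Two brackets with `L_s` push all components of `x` but `w` out of the grading, so `[a, [b,
    -- w]] = [a, [b, x]]` is a homogeneous element of `I`.
    · rw [DirectSum.decompose_of_mem_same 𝒜 hwm]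
      refine hom (br ha (br hb hwm)) ?_
      have e₁ : ⁅b, (DirectSum.decompose 𝒜 x s : L)⁆ = 0 :=
        eq_zero_of_mem_degree h3 (br hb (SetLike.coe_mem _)) (by omega) (by omega) (by omega)
      have e₀ : ⁅a, ⁅b, (DirectSum.decompose 𝒜 x 0 : L)⁆⁆ = 0 :=
        eq_zero_of_mem_degree h3 (br ha (br hb (SetLike.coe_mem _))) (by omega) (by omega)
          (by omega)
      have : ⁅a, ⁅b, x⁆⁆ ∈ I := lie_mem_right R L I _ _ (lie_mem_right R L I _ _ hx)
      rw [eq_sum_decompose h3 hs x, lie_add, e₁, add_zero, lie_add, lie_add, e₀, add_zero] at this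
      exact this
  have hann : w ∈ annihilator U := by
    intro u hu
    have e := eq_sum_decompose h3 hs u
    rw [hu.1, add_zero] at e
    have e₁ : ⁅w, (DirectSum.decompose 𝒜 u (-s) : L)⁆ = 0 :=
      eq_zero_of_mem_degree h3 (br hwm (SetLike.coe_mem _)) (by omega) (by omega) (by omega)
    rw [e, lie_add, e₁, zero_add]
    -- This bracket lies in both `I` and `U`; its component of degree `-s` is `[u₀, w]`.
    have hz : ⁅(DirectSum.decompose 𝒜 u 0 : L), x⁆ = 0 := by
      refine hIU _ (lie_mem_right R L I _ _ hx) ?_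
      rw [← lie_skew]
      exact neg_mem (lie_mem_right R L U _ _ (h0 u hu))
    have := decompose_lie_of_mem 𝒜 (SetLike.coe_mem (DirectSum.decompose 𝒜 u 0)) x (-s)
    rw [hz] at this
    rw [← lie_skew, hw, ← this]
    simp
  have : w ∈ U ⊓ annihilator U := ⟨hwU, hann⟩
  rwa [inf_annihilator, LieSubmodule.mem_bot] at this

/-- If the core were zero, elements of `I` would lose both outer components, hence be homogeneous of
degree 0 and lie in the core. -/
theorem gradedCore_ne_bot [IsSemiprime R L]
    (h3 : ∀ n : ℤ, n ≠ -1 → n ≠ 0 → n ≠ 1 → 𝒜 n = ⊥) {I : LieIdeal R L} (hI : I ≠ ⊥) :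
    gradedCore 𝒜 I ≠ ⊥ := by
  intro h
  apply hI
  rw [eq_bot_iff, ← h]
  intro x hx
  have e := eq_sum_decompose h3 (Or.inl rfl) x
  have e₁ := decompose_eq_zero_of_gradedCore_eq_bot h3 h (Or.inl rfl) hx
  have e₂ := decompose_eq_zero_of_gradedCore_eq_bot h3 h (Or.inr rfl) hx
  rw [neg_neg] at e₂
  rw [e₁, e₂, zero_add, add_zero] at e
  refine mem_gradedCore_of_mem (k := 0) ?_ hx
  rw [e]
  exact SetLike.coe_mem _

theorem IsGradedEssential.isEssential [IsSemiprime R L]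
    (h3 : ∀ n : ℤ, n ≠ -1 → n ≠ 0 → n ≠ 1 → 𝒜 n = ⊥) {I : LieIdeal R L}
    (hI : IsGradedEssential 𝒜 I) : IsEssential I := fun K hK h => by
  refine hI.2 _ (isGradedIdeal_gradedCore K) (gradedCore_ne_bot h3 hK) ?_
  rw [eq_bot_iff, ← h]
  exact inf_le_inf_left _ (gradedCore_le K)

theorem IsEssential.gradedCore [IsSemiprime R L]
    (h3 : ∀ n : ℤ, n ≠ -1 → n ≠ 0 → n ≠ 1 → 𝒜 n = ⊥) {I : LieIdeal R L}
    (hI : IsEssential I) : IsGradedEssential 𝒜 (gradedCore 𝒜 I) :=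
  ⟨isGradedIdeal_gradedCore I, fun K _ hK h => by
    refine gradedCore_ne_bot h3 (hI K hK) ?_
    rw [eq_bot_iff, ← h]
    exact le_inf (gradedCore_mono inf_le_left) ((gradedCore_le _).trans inf_le_right)⟩

end ThreeGraded

end LieQuot

namespace LieQuot

/-! ### Homogeneous elements of graded ideals. -/

section Homogeneous

variable {R L G : Type*} [CommRing R] [LieRing L] [LieAlgebra R L] [AddCommGroup G]
  {𝒜 : G → Submodule R L}

theorem restrict_mem_derDegree {I J : LieIdeal R L} (h : I ≤ J) {δ : LieDerivation R J L} {n : G}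
    (hδ : δ ∈ derDegree 𝒜 J n) : restrict h δ ∈ derDegree 𝒜 I n :=
  fun τ x hx => hδ τ ⟨x, h x.2⟩ hx

variable [DecidableEq G] [GradedLieAlgebra 𝒜] {I : LieIdeal R L}

variable (𝒜) in
/-- The projection of a graded module onto its homogeneous component of degree `n`. -/
def homogeneousProj (n : G) : L →ₗ[R] L :=
  (𝒜 n).subtype ∘ₗ DirectSum.component R G (fun i => 𝒜 i) n ∘ₗ
    (DirectSum.decomposeLinearEquiv 𝒜).toLinearMap

theorem homogeneousProj_apply (n : G) (x : L) :
    homogeneousProj 𝒜 n x = (DirectSum.decompose 𝒜 x n : L) := rfl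

/-- The restriction to a graded ideal of the projection onto a homogeneous component. -/
def IsGradedIdeal.proj (hI : IsGradedIdeal 𝒜 I) (n : G) : I →ₗ[R] I :=
  (homogeneousProj 𝒜 n).restrict fun x hx => hI x hx n

theorem IsGradedIdeal.induction (hI : IsGradedIdeal 𝒜 I) {p : I → Prop} (zero : p 0)
    (add : ∀ x y, p x → p y → p (x + y)) (homogeneous : ∀ n (x : I), (x : L) ∈ 𝒜 n → p x)
    (x : I) : p x := by
  classical
  have h : x = ∑ n ∈ (DirectSum.decompose 𝒜 (x : L)).support, hI.proj n x := by
    apply Subtype.ext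
    conv_lhs => rw [← DirectSum.sum_support_decompose 𝒜 (x : L)]
    rw [AddSubmonoidClass.coe_finsetSum]
    rfl
  rw [h]
  exact Finset.sum_induction _ p add zero fun n _ => homogeneous n _ (SetLike.coe_mem _)

theorem IsGradedIdeal.ext (hI : IsGradedIdeal 𝒜 I) {δ : LieDerivation R I L}
    (h : ∀ n (x : I), (x : L) ∈ 𝒜 n → δ x = 0) : δ = 0 := by
  apply LieDerivation.ext
  intro x
  induction x using hI.induction with
  | zero => rw [map_zero, map_zero]
  | add x y hx hy => rw [map_add, map_add, hx, hy]
  | homogeneous n x hx => exact h n x hx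

end Homogeneous

/-! ### Homogeneous components of derivations. -/

section Components

variable {R L : Type*} [CommRing R] [LieRing L] [LieAlgebra R L]
  {𝒜 : ℤ → Submodule R L} [GradedLieAlgebra 𝒜] {I : LieIdeal R L}

/-- The component of degree `n` of a linear map from a graded ideal of a 3-graded Lie algebra. -/
noncomputable def IsGradedIdeal.linearComponent (hI : IsGradedIdeal 𝒜 I) (f : I →ₗ[R] L) (n : ℤ) : I →ₗ[R] L :=
  ∑ k ∈ Finset.Icc (-1 : ℤ) 1, homogeneousProj 𝒜 (k + n) ∘ₗ f ∘ₗ hI.proj k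

theorem IsGradedIdeal.linearComponent_apply
    (h3 : ∀ n : ℤ, n ≠ -1 → n ≠ 0 → n ≠ 1 → 𝒜 n = ⊥) (hI : IsGradedIdeal 𝒜 I) (f : I →ₗ[R] L)
    (n : ℤ) {j : ℤ} {x : I} (hx : (x : L) ∈ 𝒜 j) :
    hI.linearComponent f n x = (DirectSum.decompose 𝒜 (f x) (j + n) : L) := by
  have same : hI.proj j x = x := Subtype.ext (DirectSum.decompose_of_mem_same 𝒜 hx)
  have ne : ∀ k, k ≠ j → hI.proj k x = 0 := fun k hk =>
    Subtype.ext (DirectSum.decompose_of_mem_ne 𝒜 hx hk.symm)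
  rw [IsGradedIdeal.linearComponent, LinearMap.sum_apply, Finset.sum_eq_single j]
  · rw [LinearMap.comp_apply, LinearMap.comp_apply, same, homogeneousProj_apply]
  · intro k _ hk
    rw [LinearMap.comp_apply, LinearMap.comp_apply, ne k hk, map_zero, map_zero]
  · intro hj
    have : x = 0 := Subtype.ext (eq_zero_of_mem_degree h3 hx
      (by rintro rfl; simp at hj) (by rintro rfl; simp at hj) (by rintro rfl; simp at hj))
    rw [this, map_zero]

/-- The component of degree `n` of a derivation from a graded ideal of a 3-graded Lie algebra. -/
noncomputable def IsGradedIdeal.derComponent (h3 : ∀ n : ℤ, n ≠ -1 → n ≠ 0 → n ≠ 1 → 𝒜 n = ⊥)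
    (hI : IsGradedIdeal 𝒜 I) (δ : LieDerivation R I L) (n : ℤ) : LieDerivation R I L where
  toLinearMap := hI.linearComponent δ.toLinearMap n
  leibniz' a b := by
    induction a using hI.induction with
    | zero => simp
    | add x y hx hy =>
      rw [add_lie, map_add, hx, hy, add_lie, map_add, lie_add]
      abel
    | homogeneous j a ha =>
      induction b using hI.induction with
      | zero => simp
      | add x y hx hy =>
        rw [lie_add, map_add, hx, hy, add_lie, map_add, lie_add]
        abel
      | homogeneous k b hb =>
        -- On homogeneous elements the Leibniz rule for the component is that of `δ`, read in degree
        -- `j + k + n`.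
        have hab : ((⁅a, b⁆ : I) : L) ∈ 𝒜 (j + k) := SetLike.GradedBracket.bracket_mem ha hb
        rw [hI.linearComponent_apply h3 _ n ha, hI.linearComponent_apply h3 _ n hb,
          hI.linearComponent_apply h3 _ n hab]
        have e : δ.toLinearMap ⁅a, b⁆ = ⁅(a : L), δ b⁆ - ⁅(b : L), δ a⁆ := δ.apply_lie_eq_sub a b
        rw [e, DirectSum.decompose_sub, DirectSum.sub_apply, Submodule.coe_sub,
          decompose_lie_of_mem' 𝒜 ha, decompose_lie_of_mem' 𝒜 hb,
          show j + k + n - j = k + n by ring, show j + k + n - k = j + n by ring]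
        rfl

theorem IsGradedIdeal.derComponent_apply
    (h3 : ∀ n : ℤ, n ≠ -1 → n ≠ 0 → n ≠ 1 → 𝒜 n = ⊥) (hI : IsGradedIdeal 𝒜 I)
    (δ : LieDerivation R I L) (n : ℤ) {j : ℤ} {x : I} (hx : (x : L) ∈ 𝒜 j) :
    hI.derComponent h3 δ n x = (DirectSum.decompose 𝒜 (δ x) (j + n) : L) :=
  hI.linearComponent_apply h3 _ n hx

theorem IsGradedIdeal.derComponent_mem (h3 : ∀ n : ℤ, n ≠ -1 → n ≠ 0 → n ≠ 1 → 𝒜 n = ⊥)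
    (hI : IsGradedIdeal 𝒜 I) (δ : LieDerivation R I L) (n : ℤ) :
    hI.derComponent h3 δ n ∈ derDegree 𝒜 I n := fun τ x hx => by
  rw [hI.derComponent_apply h3 δ n hx]
  exact SetLike.coe_mem _

/-- The range is `-2` to `2` because a nonzero component takes one degree among `-1, 0, 1` to
another. -/
theorem IsGradedIdeal.eq_sum_derComponent (h3 : ∀ n : ℤ, n ≠ -1 → n ≠ 0 → n ≠ 1 → 𝒜 n = ⊥)
    (hI : IsGradedIdeal 𝒜 I) (δ : LieDerivation R I L) :
    δ = ∑ n ∈ Finset.Icc (-2 : ℤ) 2, hI.derComponent h3 δ n := by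
  apply LieDerivation.ext
  intro x
  induction x using hI.induction with
  | zero => rw [map_zero, map_zero]
  | add x y hx hy => rw [map_add, map_add, hx, hy]
  | homogeneous j x hx =>
    have ev : (∑ n ∈ Finset.Icc (-2 : ℤ) 2, hI.derComponent h3 δ n) x =
        ∑ n ∈ Finset.Icc (-2 : ℤ) 2, hI.derComponent h3 δ n x := by
      rw [← LieDerivation.coeFnAddMonoidHom_apply, map_sum, Finset.sum_apply]
      rfl
    rw [ev]
    by_cases hj : j = -1 ∨ j = 0 ∨ j = 1
    · have e := eq_sum_decompose_of_finset (𝒜 := 𝒜) (δ x)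
        ((Finset.Icc (-2 : ℤ) 2).map (addLeftEmbedding j)) fun n hn =>
          decompose_eq_zero_of_degree h3 _
            (by rintro rfl; exact hn (Finset.mem_map.2 ⟨-1 - j, by simp; omega, by simp⟩))
            (by rintro rfl; exact hn (Finset.mem_map.2 ⟨0 - j, by simp; omega, by simp⟩))
            (by rintro rfl; exact hn (Finset.mem_map.2 ⟨1 - j, by simp; omega, by simp⟩))
      rw [Finset.sum_map] at e
      refine e.trans (Finset.sum_congr rfl fun n _ => ?_)
      rw [hI.derComponent_apply h3 δ n hx]
      rfl
    · have : x = 0 := Subtype.ext (eq_zero_of_mem_degree h3 hx (by tauto) (by tauto) (by tauto))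
      simp [this]

theorem IsGradedIdeal.mem_derGr (h3 : ∀ n : ℤ, n ≠ -1 → n ≠ 0 → n ≠ 1 → 𝒜 n = ⊥)
    (hI : IsGradedIdeal 𝒜 I) (δ : LieDerivation R I L) : δ ∈ derGr 𝒜 I := by
  rw [hI.eq_sum_derComponent h3 δ]
  exact sum_mem fun n _ => Submodule.mem_iSup_of_mem n (hI.derComponent_mem h3 δ n)

end Components

/-! ### The grading of `Q_gr-m(L)`. -/

section GradedQuotients

variable {R L G : Type*} [CommRing R] [LieRing L] [LieAlgebra R L] [AddCommGroup G] [DecidableEq G]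
  {𝒜 : G → Submodule R L} [GradedLieAlgebra 𝒜] [IsGradedSemiprime 𝒜]

theorem Qgrm.of_mem_component {i : (gradedEssentialSystem 𝒜).Index}
    (δ : (gradedEssentialSystem 𝒜).Obj i) {n : G} (hδ : δ.1 ∈ derDegree 𝒜 i.ideal n) :
    (gradedEssentialSystem 𝒜).of i δ ∈ Qgrm.component 𝒜 n :=
  Submodule.mem_iSup_of_mem i ⟨δ, hδ, rfl⟩

/-- The supremum defining the component is directed, since restriction keeps the degree, so it is a
union. -/
theorem Qgrm.mem_component {n : G} {z : Qgrm 𝒜} : z ∈ Qgrm.component 𝒜 n ↔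
    ∃ (i : (gradedEssentialSystem 𝒜).Index) (δ : (gradedEssentialSystem 𝒜).Obj i),
      δ.1 ∈ derDegree 𝒜 i.ideal n ∧ (gradedEssentialSystem 𝒜).of i δ = z := by
  have hdir : Directed (· ≤ ·) fun i : (gradedEssentialSystem 𝒜).Index =>
      ((derDegree 𝒜 i.ideal n).comap (Submodule.subtype _)).map
        ((gradedEssentialSystem 𝒜).of i) := by
    apply Monotone.directed_le
    rintro i j hij _ ⟨δ, hδ, rfl⟩
    exact ⟨(gradedEssentialSystem 𝒜).trans i j hij δ, restrict_mem_derDegree hij hδ,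
      (gradedEssentialSystem 𝒜).of_trans hij δ⟩
  rw [Qgrm.component, Submodule.mem_iSup_of_directed _ hdir]
  rfl

theorem Qgrm.lie_mem_component {m n : G} {z w : Qgrm 𝒜} (hz : z ∈ Qgrm.component 𝒜 m)
    (hw : w ∈ Qgrm.component 𝒜 n) : ⁅z, w⁆ ∈ Qgrm.component 𝒜 (m + n) := by
  obtain ⟨i, δ, hδ, rfl⟩ := Qgrm.mem_component.1 hz
  obtain ⟨j, μ, hμ, rfl⟩ := Qgrm.mem_component.1 hw
  rw [DerSystem.bracket_of_of]
  exact Qgrm.of_mem_component _ (derBracket_mem_derDegree hδ hμ)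

theorem Qgrm.toQgrm_mem_component {n : G} {x : L} (hx : x ∈ 𝒜 n) :
    toQgrm 𝒜 x ∈ Qgrm.component 𝒜 n := by
  refine Qgrm.of_mem_component (i := (gradedEssentialSystem 𝒜).index ⊤ _) ⟨adOn ⊤ x, _⟩ ?_
  intro τ y hy
  rw [add_comm]
  exact SetLike.GradedBracket.bracket_mem hx hy

theorem Qgrm.iSup_component : ⨆ n, Qgrm.component 𝒜 n = ⊤ := by
  rw [eq_top_iff]
  rintro z -
  obtain ⟨i, ⟨δ, hδ⟩, rfl⟩ := (gradedEssentialSystem 𝒜).exists_of z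
  have hδ' : δ ∈ ⨆ n, derDegree 𝒜 i.ideal n := hδ
  have H : ∀ δ ∈ ⨆ n, derDegree 𝒜 i.ideal n, ∀ h : δ ∈ (gradedEssentialSystem 𝒜).der i.ideal,
      (gradedEssentialSystem 𝒜).of i ⟨δ, h⟩ ∈ ⨆ n, Qgrm.component 𝒜 n := by
    intro δ hδ
    induction hδ using Submodule.iSup_induction' with
    | mem n δ hδ =>
      exact fun h => Submodule.mem_iSup_of_mem n (Qgrm.of_mem_component ⟨δ, h⟩ hδ)
    | zero =>
      intro h
      have : (gradedEssentialSystem 𝒜).of i ⟨0, h⟩ = 0 := map_zero _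
      rw [this]
      exact zero_mem _
    | add δ μ hδ hμ ih ih' =>
      intro h
      have e : (gradedEssentialSystem 𝒜).of i ⟨δ + μ, h⟩ =
          (gradedEssentialSystem 𝒜).of i ⟨δ, hδ⟩ + (gradedEssentialSystem 𝒜).of i ⟨μ, hμ⟩ :=
        map_add ((gradedEssentialSystem 𝒜).of i) ⟨δ, hδ⟩ ⟨μ, hμ⟩
      rw [e]
      exact add_mem (ih hδ) (ih' hμ)
  exact H δ hδ' hδ

/-- Representatives are restricted to a common domain; on a homogeneous `y` of degree `j` their
values lie in the distinct components `𝒜 (j + m)`, so a zero sum forces each value to vanish. -/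
theorem Qgrm.iSupIndep_component : iSupIndep (Qgrm.component 𝒜) := by
  classical
  rw [iSupIndep_iff_finsetSum_eq_zero_imp_eq_zero]
  intro s v hv h0
  choose! i δ hδ hi using fun n hn => Qgrm.mem_component.1 (hv n hn)
  obtain ⟨k, hk⟩ := Finset.exists_le (s.image i)
  have hk' : ∀ n ∈ s, i n ≤ k := fun n hn => hk _ (Finset.mem_image_of_mem i hn)
  let μ : G → (gradedEssentialSystem 𝒜).Obj k := fun n =>
    if h : n ∈ s then (gradedEssentialSystem 𝒜).trans (i n) k (hk' n h) (δ n) else 0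
  have hμ : ∀ n ∈ s, (gradedEssentialSystem 𝒜).of k (μ n) = v n := fun n hn => by
    simp only [μ, dif_pos hn]
    rw [DerSystem.of_trans, hi n hn]
  have hμd : ∀ n ∈ s, (μ n).1 ∈ derDegree 𝒜 k.ideal n := fun n hn => by
    simp only [μ, dif_pos hn]
    exact restrict_mem_derDegree (hk' n hn) (hδ n hn)
  rw [← Finset.sum_congr rfl hμ, ← map_sum] at h0
  obtain ⟨I, hI, hIk, hzero⟩ := (gradedEssentialSystem 𝒜).exists_of_eq_zero h0
  intro n hn
  rw [← hμ n hn]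
  refine (gradedEssentialSystem 𝒜).of_eq_zero I hI hIk fun x hx => ?_
  have key : restrict hIk (μ n).1 = 0 := by
    refine hI.1.ext fun j y hy => ?_
    have e : ∑ m ∈ s, (μ m).1 ⟨y, hIk y.2⟩ = 0 := by
      rw [← hzero y y.2]
      exact (map_sum (AddMonoidHom.mk'
        (fun ν : (gradedEssentialSystem 𝒜).Obj k => ν.1 ⟨(y : L), hIk y.2⟩)
        fun _ _ => rfl) μ s).symm
    have ind := (DirectSum.Decomposition.isInternal 𝒜).submodule_iSupIndep
    have ind' : iSupIndep fun m => 𝒜 (j + m) := ind.comp (add_right_injective j)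
    rw [iSupIndep_iff_finsetSum_eq_zero_imp_eq_zero] at ind'
    exact ind' s _ (fun m hm => hμd m hm j ⟨y, hIk y.2⟩ hy) e n hn
  exact congrArg (fun ν : LieDerivation R I L => ν ⟨x, hx⟩) key

end GradedQuotients

end LieQuot

namespace LieQuot

/-! ### The isomorphism of the two algebras and the transported grading. -/

section Isomorphism

variable {R L : Type*} [CommRing R] [LieRing L] [LieAlgebra R L]
  {𝒜 : ℤ → Submodule R L} [GradedLieAlgebra 𝒜]

theorem derDegree_eq_zero (h3 : ∀ n : ℤ, n ≠ -1 → n ≠ 0 → n ≠ 1 → 𝒜 n = ⊥) {I : LieIdeal R L}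
    (hI : IsGradedIdeal 𝒜 I) {n : ℤ} (hn : n < -2 ∨ 2 < n) {δ : LieDerivation R I L}
    (hδ : δ ∈ derDegree 𝒜 I n) : δ = 0 := by
  refine hI.ext fun j x hx => ?_
  by_cases hj : j = -1 ∨ j = 0 ∨ j = 1
  · exact eq_zero_of_mem_degree h3 (hδ j x hx) (by omega) (by omega) (by omega)
  · have : x = 0 := Subtype.ext (eq_zero_of_mem_degree h3 hx (by tauto) (by tauto) (by tauto))
    rw [this, map_zero]

theorem Qgrm.component_eq_bot [IsGradedSemiprime 𝒜]
    (h3 : ∀ n : ℤ, n ≠ -1 → n ≠ 0 → n ≠ 1 → 𝒜 n = ⊥) {n : ℤ} (hn : n < -2 ∨ 2 < n) :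
    Qgrm.component 𝒜 n = ⊥ := by
  rw [eq_bot_iff]
  intro z hz
  obtain ⟨i, δ, hδ, rfl⟩ := Qgrm.mem_component.1 hz
  have : δ = 0 := Subtype.ext (derDegree_eq_zero h3 i.mem.1 hn hδ)
  rw [this, map_zero]
  exact zero_mem _

variable [IsSemiprime R L]

/-- A graded essential ideal of a semiprime 3-graded Lie algebra, as an essential ideal. -/
def essentialIndex (h3 : ∀ n : ℤ, n ≠ -1 → n ≠ 0 → n ≠ 1 → 𝒜 n = ⊥)
    (i : (gradedEssentialSystem 𝒜).Index) : (essentialSystem R L).Index :=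
  (essentialSystem R L).index i.ideal (IsGradedEssential.isEssential h3 i.mem)

/-- The homomorphism `Q_gr-m(L) → Q_m(L)`, `δ_I ↦ δ_I`. -/
noncomputable def Qgrm.toQm (h3 : ∀ n : ℤ, n ≠ -1 → n ≠ 0 → n ≠ 1 → 𝒜 n = ⊥) :
    Qgrm 𝒜 →ₗ[R] Qm R L :=
  (gradedEssentialSystem 𝒜).lift
    (fun i => (essentialSystem R L).of (essentialIndex h3 i) ∘ₗ
      ((gradedEssentialSystem 𝒜).der i.ideal).subtype.codRestrict
        ((essentialSystem R L).der i.ideal) fun _ => trivial)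
    fun i j h δ => (essentialSystem R L).of_trans (i := essentialIndex h3 i)
      (j := essentialIndex h3 j) h ⟨δ.1, trivial⟩

theorem Qgrm.toQm_of (h3 : ∀ n : ℤ, n ≠ -1 → n ≠ 0 → n ≠ 1 → 𝒜 n = ⊥)
    {i : (gradedEssentialSystem 𝒜).Index} (δ : (gradedEssentialSystem 𝒜).Obj i) :
    Qgrm.toQm h3 ((gradedEssentialSystem 𝒜).of i δ) =
      (essentialSystem R L).of (essentialIndex h3 i) ⟨δ.1, trivial⟩ :=
  (gradedEssentialSystem 𝒜).lift_of _ _ δ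

theorem Qgrm.toQm_lie (h3 : ∀ n : ℤ, n ≠ -1 → n ≠ 0 → n ≠ 1 → 𝒜 n = ⊥) (z w : Qgrm 𝒜) :
    Qgrm.toQm h3 ⁅z, w⁆ = ⁅Qgrm.toQm h3 z, Qgrm.toQm h3 w⁆ := by
  obtain ⟨i, δ, rfl⟩ := (gradedEssentialSystem 𝒜).exists_of z
  obtain ⟨j, μ, rfl⟩ := (gradedEssentialSystem 𝒜).exists_of w
  rw [DerSystem.bracket_of_of, toQm_of, toQm_of, toQm_of, DerSystem.bracket_of_of]
  rfl

theorem Qgrm.toQm_toQgrm (h3 : ∀ n : ℤ, n ≠ -1 → n ≠ 0 → n ≠ 1 → 𝒜 n = ⊥) (x : L) :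
    Qgrm.toQm h3 (toQgrm 𝒜 x) = LieQuot.toQm R L x :=
  Qgrm.toQm_of h3 (i := (gradedEssentialSystem 𝒜).index ⊤ IsGradedEssential.top)
    ⟨adOn ⊤ x, adOn_mem_derGr ⊤ x⟩

/-- Graded cores make graded essential ideals cofinal among essential ones. A class that vanishes on
an essential ideal vanishes on its core, and any derivation becomes graded after restriction to the
core of its domain. -/
theorem Qgrm.toQm_bijective (h3 : ∀ n : ℤ, n ≠ -1 → n ≠ 0 → n ≠ 1 → 𝒜 n = ⊥) :
    Function.Bijective (Qgrm.toQm (R := R) (𝒜 := 𝒜) h3) := by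
  constructor
  · rw [injective_iff_map_eq_zero]
    intro z hz
    obtain ⟨i, δ, rfl⟩ := (gradedEssentialSystem 𝒜).exists_of z
    rw [toQm_of] at hz
    obtain ⟨I, hI, hIi, h0⟩ := (essentialSystem R L).exists_of_eq_zero hz
    exact (gradedEssentialSystem 𝒜).of_eq_zero (gradedCore 𝒜 I) (IsEssential.gradedCore h3 hI)
      ((gradedCore_le I).trans hIi) fun x hx => h0 x (gradedCore_le I hx)
  · intro z
    obtain ⟨i, δ, rfl⟩ := (essentialSystem R L).exists_of z
    have hI : IsGradedEssential 𝒜 (gradedCore 𝒜 i.ideal) := IsEssential.gradedCore h3 i.mem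
    refine ⟨(gradedEssentialSystem 𝒜).of ((gradedEssentialSystem 𝒜).index _ hI)
      ⟨restrict (gradedCore_le i.ideal) δ.1, hI.1.mem_derGr h3 _⟩, ?_⟩
    rw [toQm_of]
    exact (essentialSystem R L).of_trans (i := i)
      (j := (essentialSystem R L).index _ (IsGradedEssential.isEssential h3 hI))
      (gradedCore_le i.ideal) δ

/-- The isomorphism `Q_gr-m(L) ≃ Q_m(L)` for a semiprime 3-graded Lie algebra. -/
noncomputable def Qgrm.equivQm (h3 : ∀ n : ℤ, n ≠ -1 → n ≠ 0 → n ≠ 1 → 𝒜 n = ⊥) :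
    Qgrm 𝒜 ≃ₗ⁅R⁆ Qm R L :=
  { LinearEquiv.ofBijective (Qgrm.toQm h3) (Qgrm.toQm_bijective h3) with
    map_lie' := fun {z w} => Qgrm.toQm_lie h3 z w }

/-- The homogeneous components of `Q_m(L)`. -/
noncomputable def Qm.component (h3 : ∀ n : ℤ, n ≠ -1 → n ≠ 0 → n ≠ 1 → 𝒜 n = ⊥) (n : ℤ) :
    Submodule R (Qm R L) :=
  (Qgrm.component 𝒜 n).map (Qgrm.equivQm h3).toLinearEquiv.toLinearMap

theorem Qm.component_isInternal (h3 : ∀ n : ℤ, n ≠ -1 → n ≠ 0 → n ≠ 1 → 𝒜 n = ⊥) :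
    DirectSum.IsInternal (Qm.component (R := R) (𝒜 := 𝒜) h3) := by
  refine DirectSum.isInternal_submodule_of_iSupIndep_of_iSup_eq_top ?_ ?_
  · exact LinearMap.iSupIndep_map _ (Qgrm.equivQm h3).toLinearEquiv.injective
      Qgrm.iSupIndep_component
  · change ⨆ n, (Qgrm.component 𝒜 n).map _ = ⊤
    rw [← Submodule.map_iSup, Qgrm.iSup_component, Submodule.map_top, LinearEquiv.range]

theorem Qm.lie_mem_component (h3 : ∀ n : ℤ, n ≠ -1 → n ≠ 0 → n ≠ 1 → 𝒜 n = ⊥) {m n : ℤ}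
    {z w : Qm R L} (hz : z ∈ Qm.component h3 m) (hw : w ∈ Qm.component h3 n) :
    ⁅z, w⁆ ∈ Qm.component h3 (m + n) := by
  obtain ⟨z, hz, rfl⟩ := hz
  obtain ⟨w, hw, rfl⟩ := hw
  exact ⟨⁅z, w⁆, Qgrm.lie_mem_component hz hw, Qgrm.toQm_lie h3 z w⟩

theorem Qm.toQm_mem_component (h3 : ∀ n : ℤ, n ≠ -1 → n ≠ 0 → n ≠ 1 → 𝒜 n = ⊥) {n : ℤ} {x : L}
    (hx : x ∈ 𝒜 n) : toQm R L x ∈ Qm.component h3 n :=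
  ⟨toQgrm 𝒜 x, Qgrm.toQgrm_mem_component hx, Qgrm.toQm_toQgrm h3 x⟩

theorem Qm.component_eq_bot_of_far (h3 : ∀ n : ℤ, n ≠ -1 → n ≠ 0 → n ≠ 1 → 𝒜 n = ⊥) {n : ℤ}
    (hn : n < -2 ∨ 2 < n) : Qm.component h3 n = ⊥ := by
  rw [Qm.component, Qgrm.component_eq_bot h3 hn, Submodule.map_bot]

theorem Qm.component_eq_bot (h3 : ∀ n : ℤ, n ≠ -1 → n ≠ 0 → n ≠ 1 → 𝒜 n = ⊥)
    (hL : IsStronglyNondegenerate L) (ht2 : ∀ x : L, 2 • x = 0 → x = 0)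
    (ht3 : ∀ x : L, 3 • x = 0 → x = 0) {n : ℤ} (h₁ : n ≠ -1) (h₂ : n ≠ 0) (h₃ : n ≠ 1) :
    Qm.component h3 n = ⊥ := by
  rw [eq_bot_iff]
  intro q hq
  rw [Submodule.mem_bot]
  refine Qm.eq_zero_of_sq_lie hL ht2 ht3 q fun l => ?_
  induction l using DirectSum.Decomposition.inductionOn 𝒜 with
  | zero => rw [map_zero, lie_zero, lie_zero]
  | @homogeneous k l =>
    by_cases hk : k = -1 ∨ k = 0 ∨ k = 1
    -- The degree is `n + (n + k)` with `|n| ≥ 2` and `|k| ≤ 1`, hence outside `-2, …, 2`.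
    · have h := Qm.lie_mem_component h3 hq
        (Qm.lie_mem_component h3 hq (Qm.toQm_mem_component h3 l.2))
      rwa [Qm.component_eq_bot_of_far h3 (by omega), Submodule.mem_bot] at h
    · rw [eq_zero_of_mem_degree h3 l.2 (by tauto) (by tauto) (by tauto), map_zero, lie_zero,
        lie_zero]
  | add a b ha hb => rw [map_add, lie_add, lie_add, ha, hb, add_zero]

theorem Qm.isStronglyNondegenerate (hL : IsStronglyNondegenerate L)
    (ht2 : ∀ x : L, 2 • x = 0 → x = 0) (ht3 : ∀ x : L, 3 • x = 0 → x = 0) :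
    IsStronglyNondegenerate (Qm R L) := fun q hq =>
  Qm.eq_zero_of_sq_lie hL ht2 ht3 q fun _ => hq _

end Isomorphism

end LieQuot

theorem mainTheorem2 {R L : Type*} [CommRing R] [LieRing L] [LieAlgebra R L]
    (𝒜 : ℤ → Submodule R L) [GradedLieAlgebra 𝒜]
    (h3 : ∀ n : ℤ, n ≠ -1 → n ≠ 0 → n ≠ 1 → 𝒜 n = ⊥) [LieQuot.IsSemiprime R L] :
    ∃ 𝒬 : ℤ → Submodule R (LieQuot.Qm R L),
      Nonempty (GradedLieAlgebra 𝒬) ∧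
      (∀ (n : ℤ), ∀ x ∈ 𝒜 n, LieQuot.toQm R L x ∈ 𝒬 n) ∧
      (∃ e : LieQuot.Qm R L ≃ₗ⁅R⁆ LieQuot.Qgrm 𝒜,
        (∀ n : ℤ, (𝒬 n).map (e : LieQuot.Qm R L →ₗ[R] LieQuot.Qgrm 𝒜) =
          LieQuot.Qgrm.component 𝒜 n) ∧
        ∀ x : L, e (LieQuot.toQm R L x) = LieQuot.toQgrm 𝒜 x) ∧
      (LieQuot.IsStronglyNondegenerate L →
        (∀ x : L, 2 • x = 0 → x = 0) → (∀ x : L, 3 • x = 0 → x = 0) →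
        (∀ n : ℤ, n ≠ -1 → n ≠ 0 → n ≠ 1 → 𝒬 n = ⊥) ∧
        LieQuot.IsStronglyNondegenerate (LieQuot.Qm R L)) := by
  refine ⟨LieQuot.Qm.component h3, ⟨?_⟩, fun n x hx => LieQuot.Qm.toQm_mem_component h3 hx,
    ⟨(LieQuot.Qgrm.equivQm h3).symm, fun n => ?_, fun x => ?_⟩, fun hL ht2 ht3 =>
    ⟨fun n h₁ h₂ h₃ => LieQuot.Qm.component_eq_bot h3 hL ht2 ht3 h₁ h₂ h₃,
      LieQuot.Qm.isStronglyNondegenerate hL ht2 ht3⟩⟩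
  · exact
      { bracket_mem := fun _ _ _ _ hz hw => LieQuot.Qm.lie_mem_component h3 hz hw
        toDecomposition := (LieQuot.Qm.component_isInternal h3).chooseDecomposition }
  · ext z
    constructor
    · rintro ⟨_, ⟨w, hw, rfl⟩, rfl⟩
      have : (LieQuot.Qgrm.equivQm h3).symm (LieQuot.Qgrm.equivQm h3 w) = w :=
        LieEquiv.symm_apply_apply _ w
      exact this.symm ▸ hw
    · intro hz
      exact ⟨LieQuot.Qgrm.equivQm h3 z, ⟨z, hz, rfl⟩, LieEquiv.symm_apply_apply _ z⟩
  · have : LieQuot.toQm R L x = LieQuot.Qgrm.equivQm h3 (LieQuot.toQgrm 𝒜 x) :=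
      (LieQuot.Qgrm.toQm_toQgrm h3 x).symm
    rw [this]
    exact LieEquiv.symm_apply_apply _ _
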